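/- Let $b\ge 4$ be an integer, and let $G$ be a finite simple graph with minimum degree $\delta\ge 1$ and independence number $\alpha>\frac{b(\delta-1)}{2}$. Then $G$ has a pseudo $[2,b]$-factor with at most $\alpha-\left\lfloor \frac{b}{2}(\delta-1)\right\rfloor$ connected components that are edges or single vertices. Here a pseudo $[2,b]$-factor of $G$ is a spanning subgraph $H$ of $G$ such that in every connected component $C$ of $H$ with at least $3$ vertices, each vertex $x$ of $C$ has degree $2\le d_C(x)\le b$. -/

import Mathlib

/-- A spanning subgraph `H` of `G` (a graph on the same vertex set, whose edges are edges of `G`)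
is a pseudo `[a,b]`-factor if in each component of `H` on at least three vertices every vertex has
degree between `a` and `b`. The degree of a vertex in its component is its degree in `H`. -/
structure SimpleGraph.IsPseudoFactor {V : Type*} [Fintype V] (G : SimpleGraph V) (a b : ℕ)
    (H : SimpleGraph V) [DecidableRel H.Adj] : Prop where
  le : H ≤ G
  degree_mem : ∀ C : H.ConnectedComponent, 3 ≤ C.supp.ncard →
    ∀ x ∈ C.supp, a ≤ H.degree x ∧ H.degree x ≤ b

/-- The number of components of `H` that are edges or vertices, that is, components on at most
two vertices. -/
noncomputable def SimpleGraph.numEdgeOrVertexComponents {V : Type*} (H : SimpleGraph V) : ℕ :=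
  {C : H.ConnectedComponent | C.supp.ncard = 2 ∨ C.supp.ncard = 1}.ncard

/-! Consider the subgraphs `F` of `G` whose degrees are 0 or in [2,b], and let r be the independence
number of the uncovered set `free F`. Such an `F` yields a pseudo factor with at most r small
components: further cycles are added until the uncovered part is a forest, and stripping leaves
covers a forest by edges and vertices represented by an independent set (`exists_forest_cover`,
`exists_isPseudoFactor`). It remains to find `F` that covers everything or satisfies b(δ-1) + 2r ≤
2α + 1.

If nothing covers everything, minimize r, then the size of a component `T` of the uncovered part,
then the degree sum over the neighbours of `T`. Exchanges through `T` show that `T` is a tree and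
that at most one neighbour of `T` has degree below b; the minimum degree then provides hubs of total
degree at least b(δ-1) - 1 (`exists_hubs`).

Every edge of `F` at a hub starts an ear of degree-two vertices. An initial piece of the ear, added
to the uncovered set, raises r (`exists_seg`), since otherwise the ear could be dropped and the
degree sum reduced. Pieces of different ears are not linked through the uncovered set
(`not_linked`), as rerouting along such a link would again reduce the sum. Hence the gains add up
inside α (`ind_union_of_not_linked`). An ear has at most two ends at hubs, so the number of ears is
at least half the hub degree sum (`sum_ndeg_le`). -/

namespace PseudoFactor

section

open scoped Classical
open SimpleGraph

set_option linter.unusedSectionVars false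

variable {V : Type*} [Fintype V]

/-! ### Degrees in spanning subgraphs -/

/-- The degree of a vertex, without decidability assumptions. -/
noncomputable def ndeg (H : SimpleGraph V) (v : V) : ℕ := (H.neighborSet v).ncard

lemma ndeg_sup {H K : SimpleGraph V} (h : ∀ a b, H.Adj a b → ¬ K.Adj a b) (v : V) :
    ndeg (H ⊔ K) v = ndeg H v + ndeg K v := by
  unfold ndeg
  rw [neighborSet_sup, Set.ncard_union_eq]
  rw [Set.disjoint_left]
  intro a ha hb
  exact h v a ha hb

lemma ndeg_sdiff {F M : SimpleGraph V} (h : M ≤ F) (v : V) :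
    ndeg (F \ M) v + ndeg M v = ndeg F v := by
  unfold ndeg
  rw [neighborSet_sdiff]
  exact Set.ncard_sdiff_add_ncard_of_subset (fun a ha => h ha)

lemma ndeg_edge {s t : V} (h : s ≠ t) (v : V) :
    ndeg (edge s t) v = (if v = s then 1 else 0) + (if v = t then 1 else 0) := by
  unfold ndeg
  have : (edge s t).neighborSet v = if v = s then {t} else if v = t then {s} else ∅ := by
    ext a
    simp only [mem_neighborSet, edge_adj]
    split_ifs <;> simp <;> grind
  rw [this]
  split_ifs <;> simp; grind

lemma ndeg_pos_of_adj {H : SimpleGraph V} {a b : V} (h : H.Adj a b) : 0 < ndeg H a :=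
  (Set.ncard_pos).2 ⟨b, h⟩

lemma ndeg_bot (v : V) : ndeg (⊥ : SimpleGraph V) v = 0 := by
  simp [ndeg]

lemma exists_adj_of_ndeg_lt {M F : SimpleGraph V} {v : V} (h : ndeg M v < ndeg F v) :
    ∃ z, F.Adj v z ∧ ¬ M.Adj v z := by
  obtain ⟨z, hz, hz'⟩ := Set.exists_mem_notMem_of_ncard_lt_ncard h
  exact ⟨z, hz, hz'⟩

lemma adj_iff_of_ndeg_le {M F : SimpleGraph V} (h : M ≤ F) {v : V} (hv : ndeg F v ≤ ndeg M v)
    {z : V} (hz : F.Adj v z) : M.Adj v z := by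
  have : M.neighborSet v = F.neighborSet v := Set.eq_of_subset_of_ncard_le (fun a ha => h ha) hv
  have h2 : z ∈ F.neighborSet v := hz
  rw [← this] at h2
  exact h2

lemma degree_eq_ndeg (H : SimpleGraph V) [DecidableRel H.Adj] (v : V) : H.degree v = ndeg H v := by
  rw [← card_neighborFinset_eq_degree, ndeg, ← Set.ncard_coe_finset, coe_neighborFinset]

/-! ### Independence numbers of vertex sets -/

/-- The independence number of the subgraph induced on `U`. -/
noncomputable def ind (G : SimpleGraph V) (U : Finset V) : ℕ :=
  (U.powerset.filter fun S : Finset V => G.IsIndepSet (S : Set V)).sup Finset.card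

lemma card_le_ind {G : SimpleGraph V} {U S : Finset V} (h : S ⊆ U)
    (hS : G.IsIndepSet (S : Set V)) : S.card ≤ ind G U :=
  Finset.le_sup (f := Finset.card) (by simp [h, hS])

lemma exists_card_eq_ind (G : SimpleGraph V) (U : Finset V) :
    ∃ S ⊆ U, G.IsIndepSet (S : Set V) ∧ S.card = ind G U := by
  obtain ⟨S, hS, h⟩ := Finset.exists_mem_eq_sup
    (U.powerset.filter fun S : Finset V => G.IsIndepSet (S : Set V)) ⟨∅, by simp⟩ Finset.card
  simp only [Finset.mem_filter, Finset.mem_powerset] at hS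
  exact ⟨S, hS.1, hS.2, h.symm⟩

lemma ind_mono {G : SimpleGraph V} {U U' : Finset V} (h : U ⊆ U') : ind G U ≤ ind G U' := by
  obtain ⟨S, hS, hi, hc⟩ := exists_card_eq_ind G U
  rw [← hc]
  exact card_le_ind (hS.trans h) hi

lemma ind_pos {G : SimpleGraph V} {U : Finset V} (h : U.Nonempty) : 0 < ind G U := by
  obtain ⟨u, hu⟩ := h
  have := card_le_ind (G := G) (U := U) (S := {u}) (by simpa using hu) (by simp)
  rw [Finset.card_singleton] at this
  omega

lemma ind_empty (G : SimpleGraph V) : ind G ∅ = 0 := by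
  obtain ⟨S, hS, -, hc⟩ := exists_card_eq_ind G ∅
  rw [← hc, Finset.subset_empty.1 hS]; rfl

lemma ind_le_indepNum (G : SimpleGraph V) (U : Finset V) : ind G U ≤ G.indepNum := by
  obtain ⟨S, hS, hi, hc⟩ := exists_card_eq_ind G U
  rw [← hc]
  exact hi.card_le_indepNum

lemma ind_union {G : SimpleGraph V} {U U' : Finset V} (hd : Disjoint U U')
    (h : ∀ a ∈ U, ∀ b ∈ U', ¬ G.Adj a b) : ind G (U ∪ U') = ind G U + ind G U' := by
  apply le_antisymm
  · obtain ⟨S, hS, hi, hc⟩ := exists_card_eq_ind G (U ∪ U')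
    have h1 := card_le_ind (G := G) (U := U) (S := S ∩ U) Finset.inter_subset_right
      (hi.mono (by simp))
    have h2 := card_le_ind (G := G) (U := U') (S := S ∩ U') Finset.inter_subset_right
      (hi.mono (by simp))
    have h3 : S = (S ∩ U) ∪ (S ∩ U') := by
      rw [← Finset.inter_union_distrib_left, Finset.inter_eq_left.2 hS]
    have h4 := Finset.card_union_le (S ∩ U) (S ∩ U')
    rw [← h3] at h4
    omega
  · obtain ⟨S, hS, hi, hc⟩ := exists_card_eq_ind G U
    obtain ⟨S', hS', hi', hc'⟩ := exists_card_eq_ind G U'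
    rw [← hc, ← hc', ← Finset.card_union_of_disjoint (Finset.disjoint_of_subset_left hS
      (Finset.disjoint_of_subset_right hS' hd))]
    apply card_le_ind (Finset.union_subset_union hS hS')
    intro a ha b hb hab
    simp only [Finset.coe_union, Set.mem_union, Finset.mem_coe] at ha hb
    rcases ha with ha | ha <;> rcases hb with hb | hb
    · exact hi ha hb hab
    · exact h a (hS ha) b (hS' hb)
    · exact fun hh => h b (hS hb) a (hS' ha) hh.symm
    · exact hi' ha hb hab

/-! ### Restricted reachability and linking -/

/-- The spanning subgraph of `G` whose edges are the edges of `G` inside `S`. -/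
def restrict (G : SimpleGraph V) (S : Finset V) : SimpleGraph V where
  Adj a b := G.Adj a b ∧ a ∈ S ∧ b ∈ S
  symm := ⟨fun _ _ h => ⟨h.1.symm, h.2.2, h.2.1⟩⟩
  loopless := ⟨fun _ h => h.1.ne rfl⟩

lemma restrict_le (G : SimpleGraph V) (S : Finset V) : restrict G S ≤ G := fun _ _ h => h.1

lemma mem_of_reachable_restrict {G : SimpleGraph V} {S : Finset V} {a b : V} (ha : a ∈ S)
    (h : (restrict G S).Reachable a b) : b ∈ S := by
  obtain ⟨p⟩ := h
  induction p with
  | nil => exact ha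
  | cons hh _ ih => exact ih hh.2.2

lemma reachable_of_induce {G : SimpleGraph V} {S : Finset V} {a b : (S : Set V)}
    (h : (G.induce (S : Set V)).Reachable a b) : (restrict G S).Reachable a b :=
  h.map (⟨Subtype.val, fun {a b} hab => ⟨hab, a.2, b.2⟩⟩ : G.induce (S : Set V) →g restrict G S)

/-- Two vertices are linked over `R` if they are adjacent or joined by a path of `G` with interior
in `R`. -/
def Linked (G : SimpleGraph V) (R : Finset V) (x x' : V) : Prop :=
  G.Adj x x' ∨ ∃ y ∈ R, ∃ y' ∈ R, G.Adj x y ∧ G.Adj x' y' ∧ (restrict G R).Reachable y y'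

/-- Let `C` be the part of `R` reachable from `X` through `R`. No edge joins `C ∪ X` to `(R \ C) ∪
X'`, so all four independence numbers split along this cut and the identity is a cancellation. -/
lemma ind_union_of_not_linked {G : SimpleGraph V} {R X X' : Finset V} (hX : Disjoint R X)
    (hX' : Disjoint R X') (hXX : Disjoint X X')
    (h : ∀ x ∈ X, ∀ x' ∈ X', ¬ Linked G R x x') :
    ind G (R ∪ X ∪ X') + ind G R = ind G (R ∪ X) + ind G (R ∪ X') := by
  set C := R.filter fun v => ∃ x ∈ X, ∃ y ∈ R, G.Adj x y ∧ (restrict G R).Reachable y v with hC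
  have hCR : C ⊆ R := Finset.filter_subset _ _
  have hCadj : ∀ a ∈ C, ∀ b ∈ R \ C, ¬ G.Adj a b := by
    intro a ha b hb hab
    simp only [hC, Finset.mem_sdiff, Finset.mem_filter, not_and] at ha hb
    obtain ⟨haR, x, hx, y, hy, hxy, hr⟩ := ha
    exact hb.2 hb.1 ⟨x, hx, y, hy, hxy, hr.trans (Adj.reachable ⟨hab, haR, hb.1⟩)⟩
  have hXC : ∀ a ∈ X, ∀ b ∈ R \ C, ¬ G.Adj a b := by
    intro a ha b hb hab
    simp only [hC, Finset.mem_sdiff, Finset.mem_filter, not_and] at hb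
    exact hb.2 hb.1 ⟨a, ha, b, hb.1, hab, Reachable.refl _⟩
  have hX'C : ∀ a ∈ C, ∀ b ∈ X', ¬ G.Adj a b := by
    intro a ha b hb hab
    simp only [hC, Finset.mem_filter] at ha
    obtain ⟨haR, x, hx, y, hy, hxy, hr⟩ := ha
    exact h x hx b hb (Or.inr ⟨y, hy, a, haR, hxy, hab.symm, hr⟩)
  have hXX' : ∀ a ∈ X, ∀ b ∈ X', ¬ G.Adj a b := fun a ha b hb hab => h a ha b hb (Or.inl hab)
  rw [Finset.disjoint_left] at hX hX' hXX
  have e1 : ind G R = ind G C + ind G (R \ C) := by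
    rw [← ind_union Finset.disjoint_sdiff hCadj, Finset.union_sdiff_of_subset hCR]
  have e2 : ind G (R ∪ X) = ind G (C ∪ X) + ind G (R \ C) := by
    rw [← ind_union]
    · congr 1; grind
    · rw [Finset.disjoint_left]; grind
    · grind
  have e3 : ind G (R ∪ X') = ind G C + ind G (R \ C ∪ X') := by
    rw [← ind_union]
    · congr 1; grind
    · rw [Finset.disjoint_left]; grind
    · grind
  have e4 : ind G (R ∪ X ∪ X') = ind G (C ∪ X) + ind G (R \ C ∪ X') := by
    rw [← ind_union]
    · congr 1; grind
    · rw [Finset.disjoint_left]; grind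
    · grind
  omega

/-! ### Paths and cycles as graphs with prescribed degrees -/

/-- Crediting one missing edge to each end makes the degree 2 on the whole path, including the
one-vertex path, whose vertex is credited twice. -/
lemma exists_path_graph {H : SimpleGraph V} {y y' : V} (p : H.Walk y y') (hp : p.IsPath) :
    ∃ N ≤ H, ∀ v, ndeg N v + (if v = y then 1 else 0) + (if v = y' then 1 else 0) =
      if v ∈ p.support then 2 else 0 := by
  induction p with
  | nil => exact ⟨⊥, bot_le, fun v => by rw [ndeg_bot]; simp; split_ifs <;> rfl⟩
  | @cons u v w h q ih =>
    rw [Walk.cons_isPath_iff] at hp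
    obtain ⟨N, hN, hd⟩ := ih hp.1
    have hu : ndeg N u = 0 := by
      have := hd u
      simp only [hp.2, if_false] at this
      omega
    have huw : u ≠ w := fun e => hp.2 (e ▸ q.end_mem_support)
    have hvq : v ∈ q.support := q.start_mem_support
    refine ⟨N ⊔ edge u v, sup_le hN ?_, fun a => ?_⟩
    · rw [edge_le_iff]; exact Or.inr h
    · rw [ndeg_sup, ndeg_edge h.ne]
      · have := hd a
        have := h.ne
        simp only [Walk.support_cons, List.mem_cons]
        split_ifs at * <;> grind
      · intro a b hab hab'
        rw [edge_adj] at hab'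
        have h1 := ndeg_pos_of_adj hab
        have h2 := ndeg_pos_of_adj hab.symm
        grind

/-- A path of `G[S]` from a neighbour of `x` to a neighbour of `x'` yields a graph that is
`2`-regular on the path and meets its complement in the end edges at `x` and `x'` only. -/
lemma exists_connector {G : SimpleGraph V} {S : Finset V} {x x' y y' : V} (hy : y ∈ S)
    (h : (restrict G S).Reachable y y') (hx : x ∉ S) (hx' : x' ∉ S) (hxy : G.Adj x y)
    (hxy' : G.Adj x' y') (hne : x ≠ x' ∨ y ≠ y') :
    ∃ N ≤ G, ∃ Y ⊆ S, y ∈ Y ∧ (∀ v ∈ Y, (restrict G S).Reachable y v) ∧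
      (∀ a b, N.Adj a b → a ∈ S ∨ b ∈ S) ∧
      ∀ v, ndeg N v = (if v ∈ Y then 2 else 0) + (if v = x then 1 else 0) +
        (if v = x' then 1 else 0) := by
  obtain ⟨p, hp⟩ := h.exists_isPath
  obtain ⟨N, hN, hd⟩ := exists_path_graph p hp
  have hy' := mem_of_reachable_restrict hy h
  have hS : ∀ v ∈ p.support, v ∈ S := fun v hv =>
    mem_of_reachable_restrict hy (p.takeUntil v hv).reachable
  refine ⟨N ⊔ edge x y ⊔ edge x' y', sup_le (sup_le (hN.trans (restrict_le G S)) ?_) ?_,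
    p.support.toFinset, fun v hv => hS v (by simpa using hv), by simp,
    fun v hv => (p.takeUntil v (by simpa using hv)).reachable, ?_, fun v => ?_⟩
  · rw [edge_le_iff]; exact Or.inr hxy
  · rw [edge_le_iff]; exact Or.inr hxy'
  · intro a b hab
    simp only [sup_adj, edge_adj] at hab
    rcases hab with (hab | hab) | hab
    · exact Or.inl (hN hab).2.1
    · grind
    · grind
  · rw [ndeg_sup, ndeg_sup, ndeg_edge hxy.ne, ndeg_edge hxy'.ne]
    · have := hd v
      simp only [List.mem_toFinset]
      omega
    · intro a b hab hab'
      have := hN hab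
      rw [edge_adj] at hab'
      have h1 := this.2.1
      have h2 := this.2.2
      grind
    · intro a b hab hab'
      simp only [sup_adj, edge_adj] at hab hab'
      rcases hab with hab | hab
      · have := hN hab
        have h1 := this.2.1
        have h2 := this.2.2
        grind
      · grind

lemma exists_cycle_graph {G : SimpleGraph V} {U : Finset V}
    (h : ¬ (G.induce (U : Set V)).IsAcyclic) :
    ∃ N ≤ G, ∃ Y ⊆ U, Y.Nonempty ∧ ∀ v, ndeg N v = if v ∈ Y then 2 else 0 := by
  unfold IsAcyclic at h
  push Not at h
  obtain ⟨u, c, hc⟩ := h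
  set f := (Embedding.induce (G := G) (U : Set V)).toHom with hf
  have hc' : (c.map f).IsCycle := (Walk.isCycle_map_iff_of_injective
    (Embedding.induce (G := G) (U : Set V)).injective).2 hc
  refine ⟨(c.map f).toSubgraph.spanningCoe, Subgraph.spanningCoe_le _, (c.map f).support.toFinset,
    ?_, ⟨f u, List.mem_toFinset.2 (Walk.start_mem_support _)⟩, fun v => ?_⟩
  · intro v hv
    simp only [Walk.support_map, List.mem_toFinset, List.mem_map] at hv
    obtain ⟨a, -, rfl⟩ := hv
    exact a.2
  · by_cases hv : v ∈ (c.map f).support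
    · rw [if_pos (by simpa using hv)]
      exact hc'.ncard_neighborSet_toSubgraph_eq_two hv
    · rw [if_neg (by simpa using hv)]
      unfold ndeg
      rw [Set.ncard_eq_zero]
      ext a
      simp only [mem_neighborSet, Subgraph.spanningCoe_adj, Set.mem_empty_iff_false, iff_false]
      intro ha
      exact hv ((Walk.mem_verts_toSubgraph _).1 ((c.map f).toSubgraph.edge_vert ha))

/-! ### Good subgraphs and extremal pairs -/

/-- Every degree is zero or lies in `[2,b]`. -/
def Good (b : ℕ) (F : SimpleGraph V) : Prop := ∀ v, ndeg F v = 0 ∨ 2 ≤ ndeg F v ∧ ndeg F v ≤ b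

/-- The set of isolated vertices. -/
noncomputable def free (F : SimpleGraph V) : Finset V := Finset.univ.filter fun v => ndeg F v = 0

lemma mem_free {F : SimpleGraph V} {v : V} : v ∈ free F ↔ ndeg F v = 0 := by simp [free]

/-- `T` is a union of components of `G[U]`. -/
def ClosedIn (G : SimpleGraph V) (T U : Finset V) : Prop :=
  T ⊆ U ∧ ∀ t ∈ T, ∀ v ∈ U, G.Adj t v → v ∈ T

/-- The reachability class of any vertex of `T` is itself closed in `U`, so by minimality it is all
of `T`. -/
lemma ClosedIn.connected {G : SimpleGraph V} {T U : Finset V} (hT : ClosedIn G T U)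
    (hne : T.Nonempty) (hmin : ∀ C, C.Nonempty → ClosedIn G C U → T.card ≤ C.card) :
    (G.induce (T : Set V)).Connected := by
  obtain ⟨t₀, ht₀⟩ := hne
  have key : ∀ y (hy : y ∈ T) y' (hy' : y' ∈ T),
      (G.induce (T : Set V)).Reachable ⟨y, hy⟩ ⟨y', hy'⟩ := by
    intro y hy y' hy'
    set C := T.filter fun v => ∃ h : v ∈ T, (G.induce (T : Set V)).Reachable ⟨y, hy⟩ ⟨v, h⟩ with hC
    have hyC : y ∈ C := by simp [hC, hy]
    have hcard := hmin C ⟨y, hyC⟩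
      ⟨(Finset.filter_subset _ _).trans hT.1, fun t ht v hv hadj => by
        simp only [hC, Finset.mem_filter] at ht ⊢
        obtain ⟨h1, h2, h3⟩ := ht
        have hvT := hT.2 t h1 v hv hadj
        exact ⟨hvT, hvT, h3.trans (Adj.reachable (by simpa using hadj))⟩⟩
    have hCT : C = T := Finset.eq_of_subset_of_card_le (Finset.filter_subset _ _) hcard
    rw [← hCT] at hy'
    simp only [hC, Finset.mem_filter] at hy'
    exact hy'.2.2
  have : Nonempty (T : Set V) := ⟨⟨t₀, ht₀⟩⟩
  exact ⟨fun a c => key a.1 a.2 c.1 c.2⟩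

/-- The neighbours of `T` outside `T`. -/
noncomputable def outer (G : SimpleGraph V) (T : Finset V) : Finset V :=
  Finset.univ.filter fun v => v ∉ T ∧ ∃ t ∈ T, G.Adj v t

lemma mem_outer {G : SimpleGraph V} {T : Finset V} {v : V} :
    v ∈ outer G T ↔ v ∉ T ∧ ∃ t ∈ T, G.Adj v t := by simp [outer]

/-- `(F, T)` lexicographically minimizes the independence number of the uncovered part, the size of
a union `T` of components of the uncovered part, and the sum of the degrees of the vertices
adjacent to `T`. -/
structure IsExtremal (G : SimpleGraph V) (b : ℕ) (F : SimpleGraph V) (T : Finset V) : Prop where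
  le : F ≤ G
  good : Good b F
  nonempty : T.Nonempty
  closed : ClosedIn G T (free F)
  ind_min : ∀ F' ≤ G, Good b F' → ind G (free F) ≤ ind G (free F')
  card_min : ∀ F' ≤ G, Good b F' → ind G (free F') ≤ ind G (free F) →
    ∀ T', T'.Nonempty → ClosedIn G T' (free F') → T.card ≤ T'.card
  sum_min : ∀ F' ≤ G, Good b F' → ind G (free F') ≤ ind G (free F) → ClosedIn G T (free F') →
    ∑ v ∈ outer G T, ndeg F v ≤ ∑ v ∈ outer G T, ndeg F' v

/-- A vertex with two distinct neighbours in `T`. -/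
def Double (G : SimpleGraph V) (T : Finset V) (w : V) : Prop :=
  ∃ y ∈ T, ∃ y' ∈ T, y ≠ y' ∧ G.Adj w y ∧ G.Adj w y'

lemma good_bot (b : ℕ) : Good b (⊥ : SimpleGraph V) := fun v => Or.inl (ndeg_bot v)

lemma exists_isExtremal (G : SimpleGraph V) (b : ℕ)
    (h : ∀ F ≤ G, Good b F → (free F).Nonempty) : ∃ F T, IsExtremal G b F T := by
  obtain ⟨F₀, ⟨hF₀, hg₀⟩, hmin₀⟩ := exists_minimalFor_of_wellFoundedLT
    (fun F : SimpleGraph V => F ≤ G ∧ Good b F) (fun F => ind G (free F)) ⟨⊥, bot_le, good_bot b⟩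
  have hmin₀' : ∀ F' ≤ G, Good b F' → ind G (free F₀) ≤ ind G (free F') := fun F' h1 h2 =>
    (le_total (ind G (free F₀)) (ind G (free F'))).elim id (fun hh => hmin₀ ⟨h1, h2⟩ hh)
  obtain ⟨⟨F₁, T⟩, ⟨hF₁, hg₁, hr₁, hT₁, hc₁⟩, hmin₁⟩ := exists_minimalFor_of_wellFoundedLT
    (fun p : SimpleGraph V × Finset V => p.1 ≤ G ∧ Good b p.1 ∧
      ind G (free p.1) ≤ ind G (free F₀) ∧ p.2.Nonempty ∧ ClosedIn G p.2 (free p.1))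
    (fun p => p.2.card) ⟨⟨F₀, free F₀⟩, hF₀, hg₀, le_rfl, h F₀ hF₀ hg₀, subset_rfl,
      fun _ _ _ h _ => h⟩
  obtain ⟨F, ⟨hF, hg, hr, hc⟩, hmin⟩ := exists_minimalFor_of_wellFoundedLT
    (fun F : SimpleGraph V => F ≤ G ∧ Good b F ∧ ind G (free F) ≤ ind G (free F₀) ∧
      ClosedIn G T (free F)) (fun F => ∑ v ∈ outer G T, ndeg F v) ⟨F₁, hF₁, hg₁, hr₁, hc₁⟩
  refine ⟨F, T, hF, hg, hT₁, hc, fun F' h1 h2 => hr.trans (hmin₀' F' h1 h2), ?_, ?_⟩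
  · intro F' h1 h2 h3 T' h4 h5
    exact (le_total T.card T'.card).elim id
      (fun hh => hmin₁ (j := (F', T')) ⟨h1, h2, h3.trans hr, h4, h5⟩ hh)
  · intro F' h1 h2 h3 h4
    exact (le_total _ _).elim id (fun hh => hmin ⟨h1, h2, h3.trans hr, h4⟩ hh)

lemma ndeg_exchange {F M N : SimpleGraph V} (hM : M ≤ F) (hN : ∀ a b, N.Adj a b → ¬ F.Adj a b)
    (v : V) : ndeg (F \ M ⊔ N) v + ndeg M v = ndeg F v + ndeg N v := by
  rw [ndeg_sup, ← ndeg_sdiff hM v]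
  · omega
  · exact fun a b h h' => hN a b h' h.1

/-! ### Exchanges through the uncovered component `T` -/

namespace IsExtremal

variable {G F : SimpleGraph V} {b : ℕ} {T : Finset V}

lemma not_mem_free (hE : IsExtremal G b F T) {v : V} (hv : v ∈ outer G T) : v ∉ free F := by
  intro h
  obtain ⟨h1, t, ht, htv⟩ := mem_outer.1 hv
  exact h1 (hE.closed.2 t ht v h htv.symm)

/-- Covering part of `T` is impossible at no cost in r. If some of `T` stays uncovered, `T \ Y` is a
smaller closed set; if not, the independence number drops by that of `T`, which is a separate block
of `U`. The set `U` may exceed `free F`, so that an exchange may also uncover vertices. -/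
lemma no_insertion (hE : IsExtremal G b F T) {F' : SimpleGraph V} {U Y : Finset V} (hF' : F' ≤ G)
    (hg : Good b F') (hU : free F' ⊆ U \ Y) (hT : ClosedIn G T U)
    (hr : ind G U ≤ ind G (free F)) (hTY : T \ Y ⊆ free F') (hY : (Y ∩ T).Nonempty) : False := by
  have hr' : ind G (free F') ≤ ind G (free F) :=
    (ind_mono (hU.trans Finset.sdiff_subset)).trans hr
  by_cases hne : (T \ Y).Nonempty
  · have := hE.card_min F' hF' hg hr' (T \ Y) hne ⟨hTY, fun t ht v hv hadj => by
      have h1 := hU hv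
      rw [Finset.mem_sdiff] at h1 ht ⊢
      exact ⟨hT.2 t ht.1 v h1.1 hadj, h1.2⟩⟩
    have h2 := Finset.card_sdiff_add_card_inter T Y
    rw [Finset.inter_comm] at h2
    have := hY.card_pos
    omega
  · rw [Finset.not_nonempty_iff_eq_empty, Finset.sdiff_eq_empty_iff_subset] at hne
    have h1 : ind G (free F') ≤ ind G (U \ T) := ind_mono (hU.trans (Finset.sdiff_subset_sdiff
      subset_rfl hne))
    have h2 : ind G U = ind G T + ind G (U \ T) := by
      rw [← ind_union Finset.disjoint_sdiff, Finset.union_sdiff_of_subset hT.1]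
      intro t ht v hv hadj
      rw [Finset.mem_sdiff] at hv
      exact hv.2 (hT.2 t ht v hv.1 hadj)
    have h3 := ind_pos (G := G) hE.nonempty
    have h4 := hE.ind_min F' hF' hg
    omega

lemma connected (hE : IsExtremal G b F T) : (G.induce (T : Set V)).Connected :=
  hE.closed.connected hE.nonempty (hE.card_min F hE.le hE.good le_rfl)

lemma reachable (hE : IsExtremal G b F T) {y y' : V} (hy : y ∈ T) (hy' : y' ∈ T) :
    (restrict G T).Reachable y y' :=
  reachable_of_induce (hE.connected.preconnected ⟨y, hy⟩ ⟨y', hy'⟩)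

lemma ndeg_of_mem (hE : IsExtremal G b F T) {v : V} (hv : v ∈ T) : ndeg F v = 0 :=
  mem_free.1 (hE.closed.1 hv)

lemma isAcyclic (hE : IsExtremal G b F T) (hb : 2 ≤ b) : (G.induce (T : Set V)).IsAcyclic := by
  by_contra h
  obtain ⟨N, hN, Y, hY, hne, hd⟩ := exists_cycle_graph h
  have hdisj : ∀ a b, N.Adj a b → ¬ F.Adj a b := by
    intro a b hab hab'
    have h1 := ndeg_pos_of_adj hab
    have h2 := ndeg_pos_of_adj hab'
    have h3 := hd a
    have h4 : a ∈ Y := by by_contra h; simp [h] at h3; omega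
    have h5 := hE.ndeg_of_mem (hY h4)
    omega
  have hsum : ∀ v, ndeg (F ⊔ N) v = ndeg F v + if v ∈ Y then 2 else 0 := fun v => by
    rw [ndeg_sup (fun a b h h' => hdisj a b h' h), hd]
  have hY0 : ∀ v ∈ Y, ndeg F v = 0 := fun v hv => hE.ndeg_of_mem (hY hv)
  refine hE.no_insertion (F' := F ⊔ N) (U := free F) (Y := Y) (sup_le hE.le hN) ?_ ?_ hE.closed
    le_rfl ?_ (by rwa [Finset.inter_eq_left.2 hY])
  · intro v
    have := hsum v
    have := hE.good v
    have := hY0 v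
    split_ifs at * <;> grind
  · intro v hv
    rw [Finset.mem_sdiff, mem_free]
    rw [mem_free] at hv
    have := hsum v
    split_ifs at * <;> grind
  · intro v hv
    rw [Finset.mem_sdiff] at hv
    rw [mem_free, hsum, hE.ndeg_of_mem hv.1, if_neg hv.2]

/-- Joining `x` and `x'` by a path through `T` contradicts extremality. -/
lemma no_path (hE : IsExtremal G b F T) (hb : 2 ≤ b) {F₀ : SimpleGraph V} {U : Finset V}
    {x x' y y' : V} (hF₀ : F₀ ≤ G) (hU : free F₀ ⊆ U) (hT : ClosedIn G T U)
    (hr : ind G U ≤ ind G (free F)) (hT₀ : T ⊆ free F₀) (hy : y ∈ T) (hy' : y' ∈ T) (hx : x ∉ T)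
    (hx' : x' ∉ T) (hxy : G.Adj x y) (hxy' : G.Adj x' y') (hne : x ≠ x' ∨ y ≠ y')
    (hd : ∀ v, v ∉ T → ndeg F₀ v + (if v = x then 1 else 0) + (if v = x' then 1 else 0) = 0 ∨
      2 ≤ ndeg F₀ v + (if v = x then 1 else 0) + (if v = x' then 1 else 0) ∧
      ndeg F₀ v + (if v = x then 1 else 0) + (if v = x' then 1 else 0) ≤ b) : False := by
  obtain ⟨N, hN, Y, hY, hyY, -, hNT, hNd⟩ :=
    exists_connector hy (hE.reachable hy hy') hx hx' hxy hxy' hne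
  have h0 : ∀ v ∈ T, ndeg F₀ v = 0 := fun v hv => mem_free.1 (hT₀ hv)
  have hdisj : ∀ a b, F₀.Adj a b → ¬ N.Adj a b := by
    intro a b hab hab'
    have h1 := ndeg_pos_of_adj hab
    have h2 := ndeg_pos_of_adj hab.symm
    rcases hNT a b hab' with h | h
    · have := h0 a h; omega
    · have := h0 b h; omega
  have hsum : ∀ v, ndeg (F₀ ⊔ N) v = ndeg F₀ v + ((if v ∈ Y then 2 else 0) +
      (if v = x then 1 else 0) + (if v = x' then 1 else 0)) := fun v => by
    rw [ndeg_sup hdisj, hNd]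
  refine hE.no_insertion (F' := F₀ ⊔ N) (U := U) (Y := Y) (sup_le hF₀ hN) ?_ ?_ hT
    hr ?_ ⟨y, by simp [hyY, hy]⟩
  · intro v
    by_cases hvT : v ∈ T
    · have h1 : v ≠ x := fun e => hx (e ▸ hvT)
      have h2 : v ≠ x' := fun e => hx' (e ▸ hvT)
      rw [hsum, h0 v hvT, if_neg h1, if_neg h2]
      split_ifs <;> omega
    · have h1 : v ∉ Y := fun e => hvT (hY e)
      have h2 := hd v hvT
      rw [hsum, if_neg h1]
      omega
  · intro v hv
    rw [mem_free, hsum] at hv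
    rw [Finset.mem_sdiff]
    refine ⟨hU (mem_free.2 (by omega)), fun h => ?_⟩
    rw [if_pos h] at hv
    omega
  · intro v hv
    rw [Finset.mem_sdiff] at hv
    have h1 : v ≠ x := fun e => hx (e ▸ hv.1)
    have h2 : v ≠ x' := fun e => hx' (e ▸ hv.1)
    rw [mem_free, hsum, h0 v hv.1, if_neg hv.2, if_neg h1, if_neg h2]

/-- Two outer vertices cannot both have spare capacity. -/
lemma eq_of_ndeg_lt (hE : IsExtremal G b F T) (hb : 2 ≤ b) {w w' : V} (hw : w ∈ outer G T)
    (hw' : w' ∈ outer G T) (hd : ndeg F w < b) (hd' : ndeg F w' < b) : w = w' := by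
  by_contra hne
  have hf := hE.not_mem_free hw
  have hf' := hE.not_mem_free hw'
  rw [mem_free] at hf hf'
  obtain ⟨h1, y, hy, hwy⟩ := mem_outer.1 hw
  obtain ⟨h1', y', hy', hwy'⟩ := mem_outer.1 hw'
  refine hE.no_path hb hE.le subset_rfl hE.closed le_rfl hE.closed.1 hy hy' h1 h1' hwy hwy'
    (Or.inl hne) fun v _ => ?_
  have := hE.good v
  split_ifs <;> grind

/-- With two units of spare capacity at `w`, a closed path from `w` through `T` back to `w` could be
added. -/
lemma le_ndeg_of_double (hE : IsExtremal G b F T) (hb : 2 ≤ b) {w : V} (hw : w ∈ outer G T)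
    (hd : Double G T w) : b ≤ ndeg F w + 1 := by
  by_contra hlt
  have hf := hE.not_mem_free hw
  rw [mem_free] at hf
  obtain ⟨h1, -⟩ := mem_outer.1 hw
  obtain ⟨y, hy, y', hy', hne, hwy, hwy'⟩ := hd
  refine hE.no_path hb hE.le subset_rfl hE.closed le_rfl hE.closed.1 hy hy' h1 h1 hwy hwy'
    (Or.inr hne) fun v _ => ?_
  have := hE.good v
  split_ifs <;> grind

/-- No exchange keeps the uncovered independence number and `T` while decreasing the degree sum,
even if a vertex with two neighbours in `T` is left with degree one. -/
lemma no_decrease (hE : IsExtremal G b F T) (hb : 3 ≤ b) {F' : SimpleGraph V} {U : Finset V} {w : V}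
    (hF' : F' ≤ G) (hw : w ∉ T) (hd : ∀ v, v ≠ w → ndeg F' v = 0 ∨ 2 ≤ ndeg F' v ∧ ndeg F' v ≤ b)
    (hdw : ndeg F' w ≤ b) (hdw' : 2 ≤ ndeg F' w ∨ 1 ≤ ndeg F' w ∧ Double G T w)
    (hU : free F' ⊆ U) (hT : ClosedIn G T U) (hr : ind G U ≤ ind G (free F)) (hT' : T ⊆ free F')
    (hs : ∑ v ∈ outer G T, ndeg F' v < ∑ v ∈ outer G T, ndeg F v) : False := by
  by_cases h2 : 2 ≤ ndeg F' w
  · have := hE.sum_min F' hF' (fun v => ?_) ((ind_mono hU).trans hr)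
      ⟨hT', fun t ht v hv hadj => hT.2 t ht v (hU hv) hadj⟩
    · omega
    · by_cases hv : v = w
      · subst hv; exact Or.inr ⟨h2, hdw⟩
      · exact hd v hv
  · rcases hdw' with h | ⟨h, y, hy, y', hy', hne, hwy, hwy'⟩
    · exact h2 h
    -- Here `w` has degree one; a cycle through `w` and `T` raises this to 3, which is allowed
    -- because `3 ≤ b`.
    · refine hE.no_path (by omega) hF' hU hT hr hT' hy hy' hw hw hwy hwy' (Or.inr hne) fun v _ => ?_
      have := hd v
      split_ifs <;> grind

end IsExtremal

/-! ### Ears and hubs -/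

/-- The vertices of degree two. -/
noncomputable def degTwo (F : SimpleGraph V) : Finset V :=
  Finset.univ.filter fun v => ndeg F v = 2

lemma mem_degTwo {F : SimpleGraph V} {v : V} : v ∈ degTwo F ↔ ndeg F v = 2 := by simp [degTwo]

/-- `Seg F w x₁ D x M`: starting with the edge from `w` to `x₁`, the path `M` runs through the
degree-two vertices of `D` and ends at the degree-two vertex `x`. -/
inductive Seg (F : SimpleGraph V) (w x₁ : V) : Finset V → V → SimpleGraph V → Prop
  | start : Seg F w x₁ ∅ x₁ (edge w x₁)
  | step {D : Finset V} {x : V} {M : SimpleGraph V} {z : V} : Seg F w x₁ D x M → F.Adj x z →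
      ¬ M.Adj x z → ndeg F z = 2 → Seg F w x₁ (insert x D) z (M ⊔ edge x z)

/-- An `F`-edge from a vertex of degree at least three to a vertex of degree two. -/
structure IsSlot (F : SimpleGraph V) (w x₁ : V) : Prop where
  adj : F.Adj w x₁
  three_le : 3 ≤ ndeg F w
  eq_two : ndeg F x₁ = 2

/-- The basic properties of a segment. -/
structure SegProps (F : SimpleGraph V) (w x₁ : V) (D : Finset V) (x : V) (M : SimpleGraph V) :
    Prop where
  le : M ≤ F
  notMem : x ∉ D
  eq_two : ∀ v ∈ insert x D, ndeg F v = 2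
  reach : ∀ v ∈ insert x D, (restrict F (degTwo F)).Reachable x₁ v
  ndeg_eq : ∀ v, ndeg M v = (if v ∈ D then 2 else 0) + (if v = x then 1 else 0) +
    (if v = w then 1 else 0)

/-- The walk never revisits a vertex: interior vertices have both their `F`-edges in `M` already,
and `w` has degree at least three while each new vertex has degree two. -/
lemma Seg.props {F M : SimpleGraph V} {w x₁ x : V} {D : Finset V} (hs : IsSlot F w x₁)
    (h : Seg F w x₁ D x M) : SegProps F w x₁ D x M := by
  induction h with
  | start =>
    refine ⟨?_, by simp, by simpa using hs.eq_two, by simp, fun v => ?_⟩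
    · rw [edge_le_iff]; exact Or.inr hs.adj
    · rw [ndeg_edge hs.adj.ne]; simp; omega
  | @step D x M z h hxz hM hz ih =>
    have hx2 := ih.eq_two x (by simp)
    have hw3 := hs.three_le
    have hzD : z ∉ insert x D := by
      intro hzD
      rw [Finset.mem_insert] at hzD
      rcases hzD with rfl | hzD
      · exact hxz.ne rfl
      · apply hM
        refine (adj_iff_of_ndeg_le ih.le (v := z) ?_ hxz.symm).symm
        rw [hz, ih.ndeg_eq, if_pos hzD]; omega
    refine ⟨sup_le ih.le ?_, hzD, ?_, ?_, fun v => ?_⟩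
    · rw [edge_le_iff]; exact Or.inr hxz
    · intro v hv
      rw [Finset.mem_insert] at hv
      rcases hv with rfl | hv
      · exact hz
      · exact ih.eq_two v hv
    · intro v hv
      rw [Finset.mem_insert] at hv
      rcases hv with rfl | hv
      · exact (ih.reach x (by simp)).trans (Adj.reachable
          ⟨hxz, mem_degTwo.2 hx2, mem_degTwo.2 hz⟩)
      · exact ih.reach v hv
    · rw [ndeg_sup, ndeg_edge hxz.ne, ih.ndeg_eq]
      · have := ih.notMem
        simp only [Finset.mem_insert]
        split_ifs <;> grind
      · intro a b hab hab'
        rw [edge_adj] at hab'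
        rcases hab'.1 with ⟨rfl, rfl⟩ | ⟨rfl, rfl⟩
        · exact hM hab
        · exact hM hab.symm

/-- A hub: a vertex adjacent to `T` from which two edges of `F` may be removed. -/
structure IsHub (G F : SimpleGraph V) (T : Finset V) (w : V) : Prop where
  mem : w ∈ outer G T
  three_le : 3 ≤ ndeg F w
  four_le : 4 ≤ ndeg F w ∨ Double G T w

/-- No vertex of `X` is adjacent to `T`. -/
def Untouched (G : SimpleGraph V) (T X : Finset V) : Prop := ∀ v ∈ X, ∀ t ∈ T, ¬ G.Adj v t

/-! ### Exchanges along a single ear -/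

namespace IsExtremal

variable {G F : SimpleGraph V} {b : ℕ} {T : Finset V}

lemma closedIn_union (hE : IsExtremal G b F T) {X : Finset V} (hX : Untouched G T X) :
    ClosedIn G T (free F ∪ X) := by
  refine ⟨hE.closed.1.trans Finset.subset_union_left, fun t ht v hv hadj => ?_⟩
  rw [Finset.mem_union] at hv
  rcases hv with hv | hv
  · exact hE.closed.2 t ht v hv hadj
  · exact (hX v hv t ht hadj.symm).elim

lemma sum_lt (hw : w ∈ outer G T) {F' : SimpleGraph V}
    (h : ∀ v, ndeg F' v ≤ ndeg F v ∨ v ∉ outer G T) (hlt : ndeg F' w < ndeg F w) :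
    ∑ v ∈ outer G T, ndeg F' v < ∑ v ∈ outer G T, ndeg F v :=
  Finset.sum_lt_sum (fun v hv => (h v).resolve_right (not_not.2 hv)) ⟨w, hw, hlt⟩

/-- Every `F`-neighbour of a hub has degree two. -/
lemma ndeg_eq_two (hE : IsExtremal G b F T) (hb : 3 ≤ b) {w v : V} (hw : IsHub G F T w)
    (hv : F.Adj w v) : ndeg F v = 2 := by
  by_contra hne
  have hpos := ndeg_pos_of_adj hv.symm
  have hle : edge w v ≤ F := by rw [edge_le_iff]; exact Or.inr hv
  have hsum : ∀ a, ndeg (F \ edge w v) a + ((if a = w then 1 else 0) + (if a = v then 1 else 0)) =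
      ndeg F a := fun a => by rw [← ndeg_edge hv.ne]; exact ndeg_sdiff hle a
  have hwv := hv.ne
  have h3 := hw.three_le
  have hfree : free (F \ edge w v) ⊆ free F := by
    intro a ha
    rw [mem_free] at ha ⊢
    have := hsum a
    have := hE.good v
    split_ifs at * <;> grind
  have hw' := hsum w
  have hgw := hE.good w
  rw [if_pos rfl, if_neg hv.ne] at hw'
  -- A neighbour `v` of degree at least three survives the deletion of the edge with degree at least
  -- two, and the degree of `w` falls.
  refine hE.no_decrease hb (F' := F \ edge w v) (U := free F) (w := w) (sdiff_le.trans hE.le)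
    (mem_outer.1 hw.mem).1 ?_ (by omega) (by omega) hfree hE.closed le_rfl ?_
    (sum_lt hw.mem (fun a => Or.inl (by have := hsum a; omega)) (by omega))
  · intro a ha
    have := hsum a
    have := hE.good a
    have := hE.good v
    split_ifs at * <;> grind
  · intro t ht
    have := hE.ndeg_of_mem ht
    have := hsum t
    rw [mem_free]
    omega

lemma isSlot (hE : IsExtremal G b F T) (hb : 3 ≤ b) {w v : V} (hw : IsHub G F T w)
    (hv : F.Adj w v) : IsSlot F w v := ⟨hv, hw.three_le, hE.ndeg_eq_two hb hw hv⟩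

/-- A segment with droppable interior does not touch `T`. -/
lemma untouched (hE : IsExtremal G b F T) (hb : 3 ≤ b) {w x₁ x : V} {D : Finset V}
    {M : SimpleGraph V} (hw : IsHub G F T w) (hx₁ : F.Adj w x₁) (h : Seg F w x₁ D x M)
    (hr : ind G (free F ∪ D) ≤ ind G (free F)) : Untouched G T (insert x D) := by
  have hs := hE.isSlot hb hw hx₁
  -- If the end `x` touches `T`, replace `M` by a path from `w` through `T` to `x`: both ends keep
  -- their degrees, and uncovering `D` costs nothing. Interior vertices are ends of shorter
  -- segments.
  have key : ∀ {D : Finset V} {x : V} {M : SimpleGraph V}, SegProps F w x₁ D x M →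
      ind G (free F ∪ D) ≤ ind G (free F) → Untouched G T D → Untouched G T (insert x D) := by
    intro D x M hp hr hD v hv t ht hvt
    rw [Finset.mem_insert] at hv
    rcases hv with rfl | hv
    swap
    · exact hD v hv t ht hvt
    obtain ⟨hwT, y, hy, hwy⟩ := mem_outer.1 hw.mem
    have hv2 := hp.eq_two v (by simp)
    have h3 := hw.three_le
    have hvT : v ∉ T := fun hvT => by have := hE.ndeg_of_mem hvT; omega
    have hsum : ∀ a, _ := fun a => ndeg_sdiff hp.le a
    simp only [hp.ndeg_eq] at hsum
    have hwv : w ≠ v := fun e => by subst e; omega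
    have hD2 : ∀ a ∈ D, ndeg F a = 2 := fun a ha => hp.eq_two a (by simp [ha])
    have hvD := hp.notMem
    refine hE.no_path (by omega) (F₀ := F \ M) (U := free F ∪ D) (x := w) (x' := v)
      (sdiff_le.trans hE.le) ?_ (hE.closedIn_union hD) hr ?_ hy ht hwT hvT hwy hvt
      (Or.inl hwv) ?_
    · intro a ha
      rw [Finset.mem_union, mem_free]
      rw [mem_free] at ha
      have := hsum a
      by_cases haD : a ∈ D
      · exact Or.inr haD
      · left
        split_ifs at * <;> grind
    · intro t ht
      rw [mem_free]
      have := hE.ndeg_of_mem ht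
      have := hsum t
      omega
    · intro a haT
      have := hsum a
      have := hE.good a
      have := hD2 a
      split_ifs at * <;> grind
  induction h with
  | start => exact key (Seg.props hs .start) hr (fun v hv => by simp at hv)
  | @step D x M z h hxz hM hz ih =>
    exact key (Seg.props hs (.step h hxz hM hz)) hr (ih ((ind_mono (Finset.union_subset_union
      subset_rfl (Finset.subset_insert x D))).trans hr))

/-- Walking along an ear from a hub, some initial segment raises the independence number. -/
lemma exists_seg (hE : IsExtremal G b F T) (hb : 3 ≤ b) {w x₁ : V} (hw : IsHub G F T w)
    (hx₁ : F.Adj w x₁) : ∃ D x M, Seg F w x₁ D x M ∧ ind G (free F ∪ D) ≤ ind G (free F) ∧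
      ind G (free F) + 1 ≤ ind G (free F ∪ insert x D) := by
  have hs := hE.isSlot hb hw hx₁
  by_contra hcon
  push Not at hcon
  -- If no segment raises the independence number, segments can be prolonged beyond the number of
  -- vertices.
  have key : ∀ n : ℕ, ∃ D x M, Seg F w x₁ D x M ∧ ind G (free F ∪ D) ≤ ind G (free F) ∧
      D.card = n := by
    intro n
    induction n with
    | zero => exact ⟨∅, x₁, _, .start, by simp, rfl⟩
    | succ n ih =>
      obtain ⟨D, x, M, hseg, hr, hc⟩ := ih
      have hr' := hcon D x M hseg hr
      have hp := hseg.props hs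
      have hunt := hE.untouched hb hw hx₁ hseg hr
      have hx2 := hp.eq_two x (by simp)
      have h3 := hw.three_le
      have hwx : x ≠ w := fun e => by subst e; omega
      obtain ⟨z, hxz, hMz⟩ : ∃ z, F.Adj x z ∧ ¬ M.Adj x z := by
        apply exists_adj_of_ndeg_lt
        rw [hp.ndeg_eq, hx2, if_neg hp.notMem, if_neg hwx, if_pos rfl]
        norm_num
      by_cases hz : ndeg F z = 2
      · exact ⟨insert x D, z, _, .step hseg hxz hMz hz, by omega, by
          rw [Finset.card_insert_of_notMem hp.notMem, hc]⟩
      -- The ear has ended at a vertex `z` of degree at least three, so the whole ear can be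
      -- deleted. When `z = w` the hub loses two edges; this is what `four_le` provides for.
      exfalso
      have hle : M ⊔ edge x z ≤ F := sup_le hp.le (by rw [edge_le_iff]; exact Or.inr hxz)
      have hsum : ∀ a, _ := fun a => ndeg_sdiff hle a
      have hadd : ∀ a, ndeg (M ⊔ edge x z) a = (if a ∈ D then 2 else 0) +
          (if a = x then 1 else 0) + (if a = w then 1 else 0) + ((if a = x then 1 else 0) +
          (if a = z then 1 else 0)) := fun a => by
        rw [ndeg_sup, hp.ndeg_eq, ndeg_edge hxz.ne]
        intro a b hab hab'
        rw [edge_adj] at hab'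
        rcases hab'.1 with ⟨rfl, rfl⟩ | ⟨rfl, rfl⟩
        · exact hMz hab
        · exact hMz hab.symm
      simp only [hadd] at hsum
      have hz0 := ndeg_pos_of_adj hxz.symm
      have hz3 : 3 ≤ ndeg F z := by have := hE.good z; omega
      have hD2 : ∀ a ∈ D, ndeg F a = 2 := fun a ha => hp.eq_two a (by simp [ha])
      have hwD : w ∉ D := fun h => by have := hD2 w h; omega
      have hxD := hp.notMem
      have hxz' := hxz.ne
      have hwx' := hwx.symm
      have hww := hsum w
      rw [if_neg hwD, if_neg hwx', if_pos rfl] at hww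
      have hgw := hE.good w
      have h4 := hw.four_le
      refine hE.no_decrease hb (F' := F \ (M ⊔ edge x z)) (U := free F ∪ insert x D) (w := w)
        (sdiff_le.trans hE.le) (mem_outer.1 hw.mem).1 ?_ (by omega) ?_ ?_
        (hE.closedIn_union hunt) (by omega) ?_
        (sum_lt hw.mem (fun a => Or.inl (by have := hsum a; omega)) (by omega))
      · intro a ha
        have := hsum a
        have := hE.good a
        have := hD2 a
        split_ifs at * <;> grind
      · rcases h4 with h4 | h4
        · left; split_ifs at hww <;> omega
        · by_cases h : 2 ≤ ndeg (F \ (M ⊔ edge x z)) w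
          · exact Or.inl h
          · refine Or.inr ⟨?_, h4⟩
            split_ifs at hww <;> omega
      · intro a ha
        rw [mem_free] at ha
        rw [Finset.mem_union, Finset.mem_insert, mem_free]
        have := hsum a
        split_ifs at * <;> grind
      · intro t ht
        have := hE.ndeg_of_mem ht
        have := hsum t
        rw [mem_free]
        omega
  obtain ⟨D, x, M, -, -, hc⟩ := key (Fintype.card V + 1)
  have := D.card_le_univ
  omega

end IsExtremal

/-! ### Links between different ears -/

lemma ClosedIn.mem_of_reachable {G : SimpleGraph V} {T R : Finset V} (hT : ClosedIn G T R)
    {a b : V} (ha : a ∈ T) (h : (restrict G R).Reachable a b) : b ∈ T := by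
  obtain ⟨p⟩ := h
  induction p with
  | nil => exact ha
  | cons hh _ ih => exact ih (hT.2 _ ha _ hh.2.2 hh.1)

/-- The connecting path avoids `T` because it stays in one component of `G[R]` and starts at a
neighbour of `x`, which is not in `T`. -/
lemma Linked.exists_graph {G : SimpleGraph V} {R T : Finset V} {x x' : V} (h : Linked G R x x')
    (hne : x ≠ x') (hx : x ∉ R) (hx' : x' ∉ R) (hT : ClosedIn G T R)
    (hxT : ∀ t ∈ T, ¬ G.Adj x t) :
    ∃ N ≤ G, ∃ Y ⊆ R, Disjoint Y T ∧
      (∀ a b, N.Adj a b → a ∈ R ∨ b ∈ R ∨ (a = x ∧ b = x') ∨ (a = x' ∧ b = x)) ∧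
      ∀ v, ndeg N v = (if v ∈ Y then 2 else 0) + (if v = x then 1 else 0) +
        (if v = x' then 1 else 0) := by
  rcases h with h | ⟨y, hy, y', hy', hxy, hxy', hr⟩
  · refine ⟨edge x x', by rw [edge_le_iff]; exact Or.inr h, ∅, by simp, by simp, ?_, fun v => ?_⟩
    · intro a b hab
      rw [edge_adj] at hab
      grind
    · rw [ndeg_edge hne]; simp
  · obtain ⟨N, hN, Y, hY, hyY, hYr, hNR, hd⟩ :=
      exists_connector hy hr hx hx' hxy hxy' (Or.inl hne)
    refine ⟨N, hN, Y, hY, ?_, fun a b hab => by have := hNR a b hab; tauto, hd⟩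
    rw [Finset.disjoint_left]
    intro v hv hvT
    exact hxT y (hT.mem_of_reachable hvT (hYr v hv).symm) hxy

namespace IsExtremal

variable {G F : SimpleGraph V} {b : ℕ} {T : Finset V}

/-- Delete both segments and join `x` to `x'` along the link. The ends keep degree two, the
interiors become uncovered for free, and the hubs lose edges, so the degree sum falls. The hubs may
coincide and then lose two edges. -/
lemma not_linked_ends (hE : IsExtremal G b F T) (hb : 3 ≤ b) {w w' x₁ x₁' x x' : V}
    {D D' : Finset V} {M M' : SimpleGraph V} (hw : IsHub G F T w) (hw' : IsHub G F T w')
    (hs : IsSlot F w x₁) (hs' : IsSlot F w' x₁')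
    (hne : ¬ (restrict F (degTwo F)).Reachable x₁ x₁') (hseg : Seg F w x₁ D x M)
    (hseg' : Seg F w' x₁' D' x' M') (hr : ind G (free F ∪ D ∪ D') ≤ ind G (free F))
    (hT : Untouched G T (insert x D)) (hT' : Untouched G T (insert x' D')) :
    ¬ Linked G (free F) x x' := by
  intro hl
  have hp := hseg.props hs
  have hp' := hseg'.props hs'
  have hdj : ∀ a ∈ insert x D, a ∉ insert x' D' := fun a ha ha' =>
    hne ((hp.reach a ha).trans (hp'.reach a ha').symm)
  have hx2 := hp.eq_two x (by simp)
  have hx2' := hp'.eq_two x' (by simp)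
  have hD2 : ∀ a ∈ D, ndeg F a = 2 := fun a ha => hp.eq_two a (by simp [ha])
  have hD2' : ∀ a ∈ D', ndeg F a = 2 := fun a ha => hp'.eq_two a (by simp [ha])
  have hw3 := hw.three_le
  have hw3' := hw'.three_le
  have hxx' : x ≠ x' := fun e => hdj x (by simp) (by simp [e])
  obtain ⟨N, hN, Y, hY, hYT, hNR, hNd⟩ := hl.exists_graph hxx'
    (fun h => by rw [mem_free] at h; omega) (fun h => by rw [mem_free] at h; omega) hE.closed
    (fun t ht => hT x (by simp) t ht)
  have hNF : ∀ a c, N.Adj a c → ¬ F.Adj a c := by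
    intro a c hac hac'
    have h1 := ndeg_pos_of_adj hac'
    have h2 := ndeg_pos_of_adj hac'.symm
    have hxadj : ¬ F.Adj x x' := fun hadj => hne ((hp.reach x (by simp)).trans
      (((Adj.reachable (G := restrict F (degTwo F))
        ⟨hadj, mem_degTwo.2 hx2, mem_degTwo.2 hx2'⟩)).trans (hp'.reach x' (by simp)).symm))
    rcases hNR a c hac with h | h | ⟨rfl, rfl⟩ | ⟨rfl, rfl⟩
    · rw [mem_free] at h; omega
    · rw [mem_free] at h; omega
    · exact hxadj hac'
    · exact hxadj hac'.symm
  -- The segments lie in different components of the degree-two graph, so they can share only the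
  -- vertex `w`, hence no edge.
  have hMM : ∀ a c, M.Adj a c → ¬ M'.Adj a c := by
    have hsupp : ∀ a, 0 < ndeg M a → 0 < ndeg M' a → a = w := by
      intro a h1 h2
      rw [hp.ndeg_eq] at h1
      rw [hp'.ndeg_eq] at h2
      by_contra haw
      have ha : a ∈ insert x D := by
        rw [Finset.mem_insert]
        split_ifs at h1 <;> grind
      have ha2 := hp.eq_two a ha
      have haw' : a ≠ w' := fun e => by subst e; omega
      have ha' : a ∈ insert x' D' := by
        rw [Finset.mem_insert]
        split_ifs at h2 <;> grind
      exact hdj a ha ha'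
    intro a c h h'
    have h1 := hsupp a (ndeg_pos_of_adj h) (ndeg_pos_of_adj h')
    have h2 := hsupp c (ndeg_pos_of_adj h.symm) (ndeg_pos_of_adj h'.symm)
    exact h.ne (h1.trans h2.symm)
  have hsum : ∀ a, _ := fun a => ndeg_exchange (sup_le hp.le hp'.le) hNF a
  simp only [ndeg_sup hMM, hp.ndeg_eq, hp'.ndeg_eq, hNd] at hsum
  have hY0 : ∀ a ∈ Y, ndeg F a = 0 := fun a ha => mem_free.1 (hY ha)
  have hxD := hp.notMem
  have hxD' := hp'.notMem
  have hdD : ∀ a ∈ D, a ∉ D' ∧ a ≠ x' := fun a ha => by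
    have := hdj a (by simp [ha])
    rw [Finset.mem_insert] at this
    tauto
  have hxx : x ∉ D' := fun h => hdj x (by simp) (by simp [h])
  have hwD : w ∉ D := fun h => by have := hD2 w h; omega
  have hwD' : w ∉ D' := fun h => by have := hD2' w h; omega
  have hwx : w ≠ x := fun e => by subst e; omega
  have hwx' : w ≠ x' := fun e => by subst e; omega
  have hwY : w ∉ Y := fun h => by have := hY0 w h; omega
  have hww := hsum w
  rw [if_neg hwD, if_neg hwD', if_neg hwx, if_neg hwx', if_neg hwY, if_pos rfl] at hww
  have hgw := hE.good w
  have h4 := hw.four_le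
  refine hE.no_decrease hb (F' := F \ (M ⊔ M') ⊔ N) (U := free F ∪ D ∪ D') (w := w)
    (sup_le (sdiff_le.trans hE.le) hN) (mem_outer.1 hw.mem).1 ?_ (by omega) ?_ ?_ ?_ hr ?_
    (sum_lt hw.mem (fun a => ?_) (by omega))
  · intro a ha
    have h := hsum a
    have hg := hE.good a
    rw [if_neg ha] at h
    by_cases haw' : a = w'
    · subst haw'
      have h1 : a ∉ D := fun h => by have := hD2 a h; omega
      have h2 : a ∉ D' := fun h => by have := hD2' a h; omega
      have h3 : a ∉ Y := fun h => by have := hY0 a h; omega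
      have h4 : a ≠ x := fun e => by subst e; omega
      have h5 : a ≠ x' := fun e => by subst e; omega
      rw [if_neg h1, if_neg h2, if_neg h3, if_neg h4, if_neg h5, if_pos rfl] at h
      omega
    rw [if_neg haw'] at h
    by_cases hax : a = x
    · subst hax
      have h3 : a ∉ Y := fun h => by have := hY0 a h; omega
      rw [if_neg hxD, if_neg hxx, if_neg h3, if_neg hxx', if_pos rfl] at h
      omega
    by_cases hax' : a = x'
    · subst hax'
      have h1 : a ∉ D := fun h => (hdD a h).2 rfl
      have h3 : a ∉ Y := fun h => by have := hY0 a h; omega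
      rw [if_neg hxD', if_neg h1, if_neg h3, if_neg hax, if_pos rfl] at h
      omega
    rw [if_neg hax, if_neg hax'] at h
    by_cases h1 : a ∈ D
    · have h2 := hD2 a h1
      have h3 : a ∉ Y := fun h => by have := hY0 a h; omega
      rw [if_pos h1, if_neg h3] at h
      omega
    by_cases h2 : a ∈ D'
    · have h4 := hD2' a h2
      have h3 : a ∉ Y := fun h => by have := hY0 a h; omega
      rw [if_pos h2, if_neg h3] at h
      omega
    rw [if_neg h1, if_neg h2] at h
    by_cases h3 : a ∈ Y
    · have := hY0 a h3
      rw [if_pos h3] at h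
      omega
    · rw [if_neg h3] at h
      omega
  · rcases h4 with h4 | h4
    · left; split_ifs at hww <;> omega
    · by_cases h : 2 ≤ ndeg (F \ (M ⊔ M') ⊔ N) w
      · exact Or.inl h
      · refine Or.inr ⟨?_, h4⟩
        split_ifs at hww <;> omega
  · intro a ha
    rw [mem_free] at ha
    rw [Finset.mem_union, Finset.mem_union, mem_free]
    have := hsum a
    by_contra hcon
    push Not at hcon
    obtain ⟨⟨h0, h1⟩, h2⟩ := hcon
    rw [ha, if_neg h1, if_neg h2] at this
    by_cases haw : a = w
    · subst haw
      split_ifs at hww <;> omega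
    by_cases haw' : a = w'
    · subst haw'
      split_ifs at this <;> omega
    by_cases hax : a = x
    · subst hax
      split_ifs at this <;> omega
    by_cases hax' : a = x'
    · subst hax'
      split_ifs at this <;> omega
    rw [if_neg haw, if_neg haw', if_neg hax, if_neg hax'] at this
    omega
  · rw [Finset.union_assoc]
    refine hE.closedIn_union fun v hv => ?_
    rw [Finset.mem_union] at hv
    rcases hv with hv | hv
    · exact hT v (by simp [hv])
    · exact hT' v (by simp [hv])
  · intro t ht
    have h0 := hE.ndeg_of_mem ht
    have h1 : t ∉ Y := fun h => Finset.disjoint_left.1 hYT h ht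
    have h2 : t ≠ x := fun e => by subst e; omega
    have h3 : t ≠ x' := fun e => by subst e; omega
    have := hsum t
    rw [if_neg h1, if_neg h2, if_neg h3] at this
    rw [mem_free]
    omega
  -- Only vertices of `Y` gain degree, and these are uncovered, hence not neighbours of `T`.
  · by_cases h : a ∈ Y
    · right
      intro ha
      exact hE.not_mem_free ha (hY h)
    · left
      have := hsum a
      rw [if_neg h] at this
      omega

/-- Induction along both segments. Once the earlier vertices are known to be unlinked,
`ind_union_of_not_linked` shows that uncovering both interiors together still costs nothing, as
`not_linked_ends` requires. -/
lemma not_linked (hE : IsExtremal G b F T) (hb : 3 ≤ b) {w w' x₁ x₁' x x' : V}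
    {D D' : Finset V} {M M' : SimpleGraph V} (hw : IsHub G F T w) (hw' : IsHub G F T w')
    (hx₁ : F.Adj w x₁) (hx₁' : F.Adj w' x₁')
    (hne : ¬ (restrict F (degTwo F)).Reachable x₁ x₁') (hseg : Seg F w x₁ D x M)
    (hseg' : Seg F w' x₁' D' x' M') (hr : ind G (free F ∪ D) ≤ ind G (free F))
    (hr' : ind G (free F ∪ D') ≤ ind G (free F)) :
    ∀ v ∈ insert x D, ∀ v' ∈ insert x' D', ¬ Linked G (free F) v v' := by
  have hs := hE.isSlot hb hw hx₁
  have hs' := hE.isSlot hb hw' hx₁'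
  have hmono : ∀ {x : V} {D : Finset V}, ind G (free F ∪ insert x D) ≤ ind G (free F) →
      ind G (free F ∪ D) ≤ ind G (free F) := fun h =>
    (ind_mono (Finset.union_subset_union subset_rfl (Finset.subset_insert _ _))).trans h
  have hends : ∀ {D x M}, Seg F w x₁ D x M → ind G (free F ∪ D) ≤ ind G (free F) →
      (∀ {D' x' M'}, Seg F w' x₁' D' x' M' → ind G (free F ∪ D') ≤ ind G (free F) →
        ∀ v ∈ D, ∀ v' ∈ insert x' D', ¬ Linked G (free F) v v') →
      ∀ {D' x' M'}, Seg F w' x₁' D' x' M' → ind G (free F ∪ D') ≤ ind G (free F) →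
        ∀ v' ∈ insert x' D', ¬ Linked G (free F) x v' := by
    intro D x M hseg hr hD
    have last : ∀ {D' x' M'}, Seg F w' x₁' D' x' M' → ind G (free F ∪ D') ≤ ind G (free F) →
        ¬ Linked G (free F) x x' := by
      intro D' x' M' hseg' hr'
      have hp := hseg.props hs
      have hp' := hseg'.props hs'
      refine hE.not_linked_ends hb hw hw' hs hs' hne hseg hseg' ?_
        (hE.untouched hb hw hx₁ hseg hr) (hE.untouched hb hw' hx₁' hseg' hr')
      have := ind_union_of_not_linked (G := G) (R := free F) (X := D) (X' := D') ?_ ?_ ?_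
        (fun v hv v' hv' => hD hseg' hr' v hv v' (by simp [hv']))
      · omega
      · rw [Finset.disjoint_left]
        intro a ha ha'
        rw [mem_free] at ha
        have := hp.eq_two a (by simp [ha'])
        omega
      · rw [Finset.disjoint_left]
        intro a ha ha'
        rw [mem_free] at ha
        have := hp'.eq_two a (by simp [ha'])
        omega
      · rw [Finset.disjoint_left]
        intro a ha ha'
        exact hne ((hp.reach a (by simp [ha])).trans (hp'.reach a (by simp [ha'])).symm)
    intro D' x' M' hseg' hr' v' hv'
    induction hseg' generalizing v' with
    | start =>
      simp only [Finset.mem_insert, Finset.notMem_empty, or_false] at hv'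
      subst hv'
      exact last .start hr'
    | @step D' x' M' z h hxz hM hz ih =>
      rw [Finset.mem_insert] at hv'
      rcases hv' with rfl | hv'
      · exact last (.step h hxz hM hz) hr'
      · exact ih (hmono hr') v' hv'
  have hall : ∀ {D x M}, Seg F w x₁ D x M → ind G (free F ∪ D) ≤ ind G (free F) →
      ∀ {D' x' M'}, Seg F w' x₁' D' x' M' → ind G (free F ∪ D') ≤ ind G (free F) →
        ∀ v ∈ insert x D, ∀ v' ∈ insert x' D', ¬ Linked G (free F) v v' := by
    intro D x M hseg
    induction hseg with
    | start =>
      intro hr D' x' M' hseg' hr' v hv v' hv'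
      simp only [Finset.mem_insert, Finset.notMem_empty, or_false] at hv
      subst hv
      exact hends .start hr (fun _ _ v hv => by simp at hv) hseg' hr' v' hv'
    | @step D x M z h hxz hM hz ih =>
      intro hr D' x' M' hseg' hr' v hv v' hv'
      rw [Finset.mem_insert] at hv
      rcases hv with rfl | hv
      · exact hends (.step h hxz hM hz) hr (ih (hmono hr)) hseg' hr' v' hv'
      · exact ih (hmono hr) hseg' hr' v hv v' hv'
  exact hall hseg hr hseg' hr'

end IsExtremal

/-! ### Counting ears -/

lemma two_mul_card_le_sum_ndeg (H : SimpleGraph V) (c : H.ConnectedComponent) :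
    2 * c.supp.toFinset.card ≤ ∑ x ∈ c.supp.toFinset, ndeg H x + 2 := by
  have h1 := c.connected_toSimpleGraph.card_vert_le_card_edgeSet_add_one
  have h2 := c.toSimpleGraph.sum_degrees_eq_twice_card_edges
  have h3 : ∑ x ∈ c.supp.toFinset, ndeg H x = ∑ x : c, c.toSimpleGraph.degree x := by
    rw [Finset.sum_subtype c.supp.toFinset (p := fun v => v ∈ c) (F := inferInstance)
      (fun v => by rw [Set.mem_toFinset]; rfl) (ndeg H)]
    refine Finset.sum_congr rfl fun x _ => ?_
    rw [degree_eq_ndeg, ndeg, ndeg, ← Set.ncard_image_of_injective _ Subtype.val_injective]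
    congr 1
    ext v
    simp only [Set.mem_image, mem_neighborSet]
    constructor
    · intro h
      exact ⟨⟨v, c.mem_supp_of_adj_mem_supp x.2 h⟩, h, rfl⟩
    · rintro ⟨a, ha, rfl⟩
      exact ha
  have h4 : Nat.card c = c.supp.toFinset.card := by
    rw [Set.toFinset_card, ← Nat.card_eq_fintype_card]; rfl
  have h5 : Nat.card c.toSimpleGraph.edgeSet = c.toSimpleGraph.edgeFinset.card := by
    rw [Nat.card_eq_fintype_card, edgeFinset_card]
  omega

/-- The `F`-edges leaving a set `B` of vertices. -/
noncomputable def slots (F : SimpleGraph V) (B : Finset V) : Finset (V × V) :=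
  (B ×ˢ Finset.univ).filter fun p => F.Adj p.1 p.2

lemma mem_slots {F : SimpleGraph V} {B : Finset V} {p : V × V} :
    p ∈ slots F B ↔ p.1 ∈ B ∧ F.Adj p.1 p.2 := by simp [slots]

lemma ndeg_eq_card_filter (F : SimpleGraph V) (w : V) :
    ndeg F w = (Finset.univ.filter fun v => F.Adj w v).card := by
  rw [ndeg, ← Set.ncard_coe_finset]
  congr 1
  ext v
  simp

lemma card_slots (F : SimpleGraph V) (B : Finset V) :
    (slots F B).card = ∑ w ∈ B, ndeg F w := by
  rw [Finset.card_eq_sum_card_fiberwise (f := Prod.fst) (t := B)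
    (fun p hp => (mem_slots.1 hp).1)]
  refine Finset.sum_congr rfl fun w hw => ?_
  rw [ndeg_eq_card_filter]
  refine Finset.card_bij' (fun p _ => p.2) (fun v _ => (w, v)) ?_ ?_ ?_ ?_
  · rintro ⟨a, v⟩ h
    simp only [Finset.mem_filter, mem_slots] at h
    obtain ⟨⟨-, h⟩, rfl⟩ := h
    simpa using h
  · intro v h
    simp only [Finset.mem_filter, Finset.mem_univ, true_and] at h
    simp [mem_slots, hw, h]
  · rintro ⟨a, v⟩ h
    simp only [Finset.mem_filter] at h
    rw [← h.2]
  · intro v h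
    rfl

/-- A path of degree-two vertices has at most two `F`-edges to the outside. -/
lemma card_slots_fiber_le (F : SimpleGraph V) (B : Finset V) (hB : ∀ w ∈ B, ndeg F w ≠ 2)
    {H : SimpleGraph V} (hH : H = restrict F (degTwo F)) (c : H.ConnectedComponent)
    (hc : c.supp ⊆ degTwo F) :
    ((slots F B).filter fun p => H.connectedComponentMk p.2 = c).card ≤ 2 := by
  have h1 := two_mul_card_le_sum_ndeg H c
  have h2 : ((slots F B).filter fun p => H.connectedComponentMk p.2 = c).card =
      ∑ x ∈ c.supp.toFinset, (B.filter fun w => F.Adj w x).card := by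
    rw [Finset.card_eq_sum_card_fiberwise (f := Prod.snd) (t := c.supp.toFinset) ?_]
    · refine Finset.sum_congr rfl fun x hx => ?_
      refine Finset.card_bij' (fun p _ => p.1) (fun v _ => (v, x)) ?_ ?_ ?_ ?_
      · rintro ⟨a, v⟩ h
        simp only [Finset.mem_filter, mem_slots] at h
        obtain ⟨⟨h, -⟩, rfl⟩ := h
        simpa using h
      · intro v h
        rw [Set.mem_toFinset, ConnectedComponent.mem_supp_iff] at hx
        simp only [Finset.mem_filter] at h
        simp [mem_slots, h.1, h.2, hx]
      · rintro ⟨a, v⟩ h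
        simp only [Finset.mem_filter] at h
        rw [← h.2]
      · intro v h
        rfl
    · intro p hp
      simp only [Finset.coe_filter, Set.mem_ofPred_eq] at hp
      simpa using hp.2
  -- Of the two `F`-edges at `x`, those to `B` are not in `H`. Connectivity makes the component's
  -- `H`-degree sum at least twice its size minus two, leaving at most two edges for `B`.
  have h3 : ∀ x ∈ c.supp.toFinset, (B.filter fun w => F.Adj w x).card + ndeg H x ≤ 2 := by
    intro x hx
    rw [Set.mem_toFinset] at hx
    have hx2 := mem_degTwo.1 (hc hx)
    rw [← hx2, ndeg_eq_card_filter F, ndeg_eq_card_filter H, ← Finset.card_union_of_disjoint]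
    · refine Finset.card_le_card fun w hw => ?_
      simp only [Finset.mem_union, Finset.mem_filter, Finset.mem_univ, true_and] at hw ⊢
      rcases hw with hw | hw
      · exact hw.2.symm
      · rw [hH] at hw
        exact hw.1
    · rw [Finset.disjoint_left]
      intro w hw hw'
      simp only [Finset.mem_filter, Finset.mem_univ, true_and] at hw hw'
      rw [hH] at hw'
      exact hB w hw.1 (mem_degTwo.1 hw'.2.2)
  have h4 := Finset.sum_le_sum h3
  rw [Finset.sum_add_distrib, Finset.sum_const, smul_eq_mul] at h4
  omega

namespace IsExtremal

variable {G F : SimpleGraph V} {b : ℕ} {T : Finset V}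

lemma sum_ndeg_le (hE : IsExtremal G b F T) (hb : 3 ≤ b) {B : Finset V}
    (hB : ∀ w ∈ B, IsHub G F T w) :
    ∑ w ∈ B, ndeg F w + 2 * ind G (free F) ≤ 2 * G.indepNum := by
  set H := restrict F (degTwo F) with hH
  set E := (slots F B).image fun p => H.connectedComponentMk p.2 with hEdef
  have hex : ∀ c ∈ E, ∃ w x₁ D x M, w ∈ B ∧ F.Adj w x₁ ∧ H.connectedComponentMk x₁ = c ∧
      Seg F w x₁ D x M ∧ ind G (free F ∪ D) ≤ ind G (free F) ∧
      ind G (free F) + 1 ≤ ind G (free F ∪ insert x D) := by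
    intro c hc
    obtain ⟨p, hp, rfl⟩ := Finset.mem_image.1 hc
    obtain ⟨h1, h2⟩ := mem_slots.1 hp
    obtain ⟨D, x, M, h⟩ := hE.exists_seg hb (hB _ h1) h2
    exact ⟨p.1, p.2, D, x, M, h1, h2, rfl, h⟩
  have hcard : ∑ w ∈ B, ndeg F w ≤ 2 * E.card := by
    rw [← card_slots]
    refine Finset.card_le_mul_card_image _ 2 fun c hc => ?_
    refine card_slots_fiber_le F B (fun w hw => by have := (hB w hw).three_le; omega) hH c ?_
    obtain ⟨w, x₁, -, -, -, hw, hx, rfl, -⟩ := hex c hc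
    intro v hv
    rw [ConnectedComponent.mem_supp_iff, ConnectedComponent.eq] at hv
    exact mem_of_reachable_restrict (mem_degTwo.2 (hE.ndeg_eq_two hb (hB w hw) hx)) hv.symm
  have : Nonempty V := ⟨hE.nonempty.choose⟩
  choose! w x₁ D x M hw hx hmk hseg hr hr' using hex
  have hprops : ∀ c ∈ E, SegProps F (w c) (x₁ c) (D c) (x c) (M c) := fun c hc =>
    (hseg c hc).props (hE.isSlot hb (hB _ (hw c hc)) (hx c hc))
  have hcomp : ∀ c ∈ E, ∀ v ∈ insert (x c) (D c), H.connectedComponentMk v = c := by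
    intro c hc v hv
    conv_rhs => rw [← hmk c hc]
    exact (ConnectedComponent.eq.2 ((hprops c hc).reach v hv)).symm
  have hdisj : ∀ c ∈ E, Disjoint (free F) (insert (x c) (D c)) := by
    intro c hc
    rw [Finset.disjoint_left]
    intro a ha ha'
    have := (hprops c hc).eq_two a ha'
    rw [mem_free] at ha
    omega
  -- Ears are added one at a time; each is unlinked from the earlier ones and contributes its own
  -- gain of at least one.
  have main : ∀ E' ⊆ E, ind G (free F) + E'.card ≤
      ind G (free F ∪ E'.biUnion fun c => insert (x c) (D c)) := by
    intro E'
    induction E' using Finset.induction_on with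
    | empty => intro _; simp
    | insert c E' hc ih =>
      intro hsub
      have hcE : c ∈ E := hsub (Finset.mem_insert_self c E')
      have hsub' : E' ⊆ E := (Finset.subset_insert c E').trans hsub
      have h1 := ih hsub'
      have h2 := ind_union_of_not_linked (G := G) (R := free F)
        (X := E'.biUnion fun c => insert (x c) (D c)) (X' := insert (x c) (D c)) ?_ (hdisj c hcE)
        ?_ ?_
      · have h3 := hr' c hcE
        rw [Finset.biUnion_insert, Finset.card_insert_of_notMem hc, Finset.union_comm (insert _ _),
          ← Finset.union_assoc]
        omega
      · rw [Finset.disjoint_biUnion_right]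
        exact fun c' hc' => hdisj c' (hsub' hc')
      · rw [Finset.disjoint_biUnion_left]
        intro c' hc'
        rw [Finset.disjoint_left]
        intro a ha ha'
        have := hcomp c' (hsub' hc') a ha
        rw [hcomp c hcE a ha'] at this
        exact hc (this ▸ hc')
      · intro v hv v' hv'
        obtain ⟨c', hc', hv⟩ := Finset.mem_biUnion.1 hv
        refine hE.not_linked hb (hB _ (hw c' (hsub' hc'))) (hB _ (hw c hcE)) (hx c' (hsub' hc'))
          (hx c hcE) ?_ (hseg c' (hsub' hc')) (hseg c hcE) (hr c' (hsub' hc')) (hr c hcE) v hv v' hv'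
        intro hreach
        have := ConnectedComponent.eq.2 hreach
        rw [← hH, hmk c' (hsub' hc'), hmk c hcE] at this
        exact hc (this ▸ hc')
  have := main E subset_rfl
  have := ind_le_indepNum G (free F ∪ E.biUnion fun c => insert (x c) (D c))
  omega

end IsExtremal

/-! ### Leaves and the supply of hubs -/

lemma exists_two_leaves {G : SimpleGraph V} {T : Finset V} (h : (G.induce (T : Set V)).IsTree)
    (hT : 2 ≤ T.card) : ∃ u ∈ T, ∃ u' ∈ T, u ≠ u' ∧ (T.filter (G.Adj u)).card = 1 ∧
      (T.filter (G.Adj u')).card = 1 := by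
  have : Nontrivial (T : Set V) := by
    obtain ⟨a, ha, c, hc, hne⟩ := Finset.one_lt_card.1 hT
    exact ⟨⟨a, ha⟩, ⟨c, hc⟩, fun e => hne (congrArg Subtype.val e)⟩
  have hdeg : ∀ a : (T : Set V), (G.induce (T : Set V)).degree a = (T.filter (G.Adj a)).card := by
    intro a
    rw [degree_eq_ndeg, ndeg, ← Set.ncard_image_of_injective _ Subtype.val_injective,
      ← Set.ncard_coe_finset]
    congr 1
    ext v
    simp
    tauto
  obtain ⟨u, u', hne, hu, hu'⟩ := h.exists_ne_and_degree_eq_one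
  rw [hdeg] at hu hu'
  exact ⟨u, u.2, u', u'.2, fun e => hne (Subtype.ext e), hu, hu'⟩

lemma exists_leaf {G : SimpleGraph V} {U : Finset V}
    (h : ∀ T ⊆ U, (G.induce (T : Set V)).IsAcyclic) (hU : U.Nonempty) :
    ∃ u ∈ U, (U.filter (G.Adj u)).card ≤ 1 := by
  obtain ⟨T, ⟨hne, hT⟩, hmin⟩ := exists_minimalFor_of_wellFoundedLT
    (fun T => T.Nonempty ∧ ClosedIn G T U) Finset.card ⟨U, hU, subset_rfl, fun _ _ _ h _ => h⟩
  have hconn := hT.connected hne fun C h1 h2 =>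
    (le_total T.card C.card).elim id fun hh => hmin ⟨h1, h2⟩ hh
  have hfilter : ∀ u ∈ T, U.filter (G.Adj u) ⊆ T.filter (G.Adj u) := by
    intro u hu v hv
    rw [Finset.mem_filter] at hv ⊢
    exact ⟨hT.2 u hu v hv.1 hv.2, hv.2⟩
  by_cases hc : 2 ≤ T.card
  · obtain ⟨u, hu, -, -, -, h1, -⟩ := exists_two_leaves ⟨hconn, h T hT.1⟩ hc
    exact ⟨u, hT.1 hu, h1 ▸ Finset.card_le_card (hfilter u hu)⟩
  · obtain ⟨u, hu⟩ := hne
    refine ⟨u, hT.1 hu, (Finset.card_le_card ((hfilter u hu).trans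
      (Finset.filter_subset _ _))).trans (by omega)⟩

namespace IsExtremal

variable {G F : SimpleGraph V} {b : ℕ} {T : Finset V}

lemma minDegree_le_card {u : V} (hu : u ∈ T) :
    G.minDegree ≤ ((outer G T).filter (G.Adj u)).card + (T.filter (G.Adj u)).card := by
  refine (G.minDegree_le_degree u).trans ?_
  rw [degree_eq_ndeg, ndeg_eq_card_filter]
  refine le_trans (Finset.card_le_card fun v hv => ?_) (Finset.card_union_le _ _)
  rw [Finset.mem_filter] at hv
  rw [Finset.mem_union, Finset.mem_filter, Finset.mem_filter, mem_outer]
  by_cases hvT : v ∈ T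
  · exact Or.inr ⟨hvT, hv.2⟩
  · exact Or.inl ⟨⟨hvT, u, hu, hv.2.symm⟩, hv.2⟩

/-- If `T` has at least δ outer neighbours, discard the possible one of degree below b. Otherwise
the tree `T` has two leaves, each with at least δ-1 outer neighbours; so there are exactly δ-1 of
them, all adjacent to both leaves. They are then double, and only one can have degree b-1, which
accounts for the `+ 1`. -/
lemma exists_hubs (hE : IsExtremal G b F T) (hb : 4 ≤ b) :
    ∃ B, (∀ w ∈ B, IsHub G F T w) ∧ b * (G.minDegree - 1) ≤ ∑ w ∈ B, ndeg F w + 1 := by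
  by_cases hA : G.minDegree ≤ (outer G T).card
  · set B := (outer G T).filter fun w => b ≤ ndeg F w with hBdef
    have h1 : ((outer G T).filter fun w => ¬ b ≤ ndeg F w).card ≤ 1 := by
      rw [Finset.card_le_one]
      intro w hw w' hw'
      simp only [Finset.mem_filter, not_le] at hw hw'
      exact hE.eq_of_ndeg_lt (by omega) hw.1 hw'.1 hw.2 hw'.2
    have h2 : B.card + ((outer G T).filter fun w => ¬ b ≤ ndeg F w).card = (outer G T).card :=
      Finset.card_filter_add_card_filter_not _
    refine ⟨B, fun w hw => ?_, ?_⟩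
    · obtain ⟨h3, h4⟩ := Finset.mem_filter.1 hw
      exact ⟨h3, by omega, Or.inl (by omega)⟩
    · have h3 : B.card * b ≤ ∑ w ∈ B, ndeg F w := by
        rw [← smul_eq_mul]
        exact Finset.card_nsmul_le_sum _ _ _ fun w hw => (Finset.mem_filter.1 hw).2
      have h4 : b * (G.minDegree - 1) ≤ B.card * b := by
        rw [mul_comm]
        exact Nat.mul_le_mul_right b (by omega)
      omega
  · have htree : (G.induce (T : Set V)).IsTree := ⟨hE.connected, hE.isAcyclic (by omega)⟩
    have hT : 2 ≤ T.card := by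
      by_contra hT
      obtain ⟨u, hu⟩ := hE.nonempty
      have h1 := minDegree_le_card (G := G) hu
      have h2 := Finset.card_filter_le (outer G T) (G.Adj u)
      have h3 : T.filter (G.Adj u) = ∅ := by
        rw [Finset.filter_eq_empty_iff]
        intro v hv hadj
        exact hadj.ne (Finset.card_le_one.1 (by omega) u hu v hv)
      rw [h3, Finset.card_empty] at h1
      omega
    obtain ⟨u, hu, u', hu', hne, h1, h1'⟩ := exists_two_leaves htree hT
    have hall : ∀ u ∈ T, (T.filter (G.Adj u)).card = 1 →
        (outer G T).card = G.minDegree - 1 ∧ ∀ w ∈ outer G T, G.Adj w u := by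
      intro u hu h1
      have h2 := minDegree_le_card (G := G) hu
      have h3 := Finset.card_filter_le (outer G T) (G.Adj u)
      refine ⟨by omega, fun w hw => ?_⟩
      have h4 := Finset.eq_of_subset_of_card_le (Finset.filter_subset (G.Adj u) (outer G T))
        (by omega)
      rw [← h4] at hw
      exact (Finset.mem_filter.1 hw).2.symm
    have hdouble : ∀ w ∈ outer G T, Double G T w := fun w hw =>
      ⟨u, hu, u', hu', hne, (hall u hu h1).2 w hw, (hall u' hu' h1').2 w hw⟩
    have hge : ∀ w ∈ outer G T, b ≤ ndeg F w + 1 := fun w hw =>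
      hE.le_ndeg_of_double (by omega) hw (hdouble w hw)
    refine ⟨outer G T, fun w hw => ⟨hw, by have := hge w hw; omega, Or.inr (hdouble w hw)⟩, ?_⟩
    rw [← (hall u hu h1).1, mul_comm]
    by_cases hlow : ∃ w ∈ outer G T, ndeg F w < b
    · obtain ⟨w, hw, hlt⟩ := hlow
      have h2 : ((outer G T).erase w).card • b ≤ ∑ v ∈ (outer G T).erase w, ndeg F v := by
        refine Finset.card_nsmul_le_sum _ _ _ fun v hv => ?_
        rw [Finset.mem_erase] at hv
        by_contra hv'
        exact hv.1 (hE.eq_of_ndeg_lt (by omega) hv.2 hw (by omega) hlt)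
      have h3 := Finset.add_sum_erase (outer G T) (ndeg F) hw
      have h4 := hge w hw
      rw [← Finset.card_erase_add_one hw, add_mul, one_mul]
      rw [smul_eq_mul] at h2
      omega
    · push Not at hlow
      have h2 : (outer G T).card * b ≤ ∑ v ∈ outer G T, ndeg F v := by
        rw [← smul_eq_mul]
        exact Finset.card_nsmul_le_sum _ _ _ hlow
      omega

lemma minDegree_bound (hE : IsExtremal G b F T) (hb : 4 ≤ b) :
    b * (G.minDegree - 1) + 2 * ind G (free F) ≤ 2 * G.indepNum + 1 := by
  obtain ⟨B, hB, hsum⟩ := hE.exists_hubs hb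
  have := hE.sum_ndeg_le (by omega) hB
  omega

end IsExtremal

/-! ### Covering the uncovered forest and assembling the factor -/

/-- A forest is covered by edges and vertices represented by the members of an independent set. -/
lemma exists_forest_cover {G : SimpleGraph V} (n : ℕ) :
    ∀ U : Finset V, U.card ≤ n → (∀ T ⊆ U, (G.induce (T : Set V)).IsAcyclic) →
    ∃ M ≤ G, ∃ I ⊆ U, G.IsIndepSet (I : Set V) ∧ (∀ a c, M.Adj a c → a ∈ U) ∧
      (∀ v, ndeg M v ≤ 1) ∧ ∀ v ∈ U, v ∈ I ∨ ∃ i ∈ I, M.Adj v i := by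
  induction n with
  | zero =>
    intro U hU _
    rw [Nat.le_zero, Finset.card_eq_zero] at hU
    subst hU
    exact ⟨⊥, bot_le, ∅, subset_rfl, by simp, by simp, by simp [ndeg_bot], by simp⟩
  | succ n ih =>
    intro U hU hac
    by_cases hne : U.Nonempty
    swap
    · exact ih U (by simp [Finset.not_nonempty_iff_eq_empty.1 hne]) hac
    obtain ⟨u, hu, hle⟩ := exists_leaf hac hne
    -- Remove the vertex `u` together with its at most one neighbour in `U`; then `u` can join the
    -- independent set and represents the removed edge or vertex.
    have hsub : U.filter (fun v => v ≠ u ∧ ¬ G.Adj u v) ⊆ U := Finset.filter_subset _ _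
    have hlt : (U.filter (fun v => v ≠ u ∧ ¬ G.Adj u v)).card < U.card :=
      Finset.card_lt_card ⟨hsub, fun h => by have := h hu; simp at this⟩
    obtain ⟨M, hM, I, hI, hind, hMU, hdeg, hcov⟩ := ih _ (by omega) fun T hT => hac T (hT.trans hsub)
    have hind' : G.IsIndepSet ((insert u I : Finset V) : Set V) := by
      have hu' : ∀ i ∈ I, ¬ G.Adj u i := fun i hi => (Finset.mem_filter.1 (hI hi)).2.2
      intro a ha c hc hac
      rw [Finset.mem_coe, Finset.mem_insert] at ha hc
      rcases ha with rfl | ha <;> rcases hc with rfl | hc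
      · exact (hac rfl).elim
      · exact hu' c hc
      · exact fun h => hu' a ha h.symm
      · exact hind ha hc hac
    have hI' : insert u I ⊆ U := Finset.insert_subset hu (hI.trans hsub)
    by_cases ht : ∃ t ∈ U, G.Adj u t
    · obtain ⟨t, ht, hut⟩ := ht
      have huniq : ∀ v ∈ U, G.Adj u v → v = t := fun v hv huv =>
        Finset.card_le_one.1 hle v (by simp [hv, huv]) t (by simp [ht, hut])
      have h0 : ∀ v, v = u ∨ v = t → ndeg M v = 0 := by
        intro v hv
        by_contra hne
        obtain ⟨z, hz⟩ := (Set.ncard_pos).1 (Nat.pos_of_ne_zero hne)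
        have := (Finset.mem_filter.1 (hMU v z hz)).2
        rcases hv with rfl | rfl
        · exact this.1 rfl
        · exact this.2 hut
      refine ⟨M ⊔ edge u t, sup_le hM (by rw [edge_le_iff]; exact Or.inr hut), insert u I, hI',
        hind', ?_, ?_, ?_⟩
      · intro a c hac
        rw [sup_adj, edge_adj] at hac
        rcases hac with hac | ⟨⟨rfl, rfl⟩ | ⟨rfl, rfl⟩, -⟩
        · exact hsub (hMU a c hac)
        · exact hu
        · exact ht
      · intro v
        rw [ndeg_sup, ndeg_edge hut.ne]
        · have := h0 v
          have := hdeg v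
          have := hut.ne
          split_ifs <;> grind
        · intro a c hac hac'
          rw [edge_adj] at hac'
          have h1 := ndeg_pos_of_adj hac
          have h2 := h0 a (by tauto)
          omega
      · intro v hv
        by_cases hvu : v = u
        · exact Or.inl (by simp [hvu])
        by_cases hvt : G.Adj u v
        · obtain rfl := huniq v hv hvt
          exact Or.inr ⟨u, by simp, by
            rw [sup_adj, edge_adj]; exact Or.inr ⟨Or.inr ⟨rfl, rfl⟩, hvu⟩⟩
        · rcases hcov v (by simp [hv, hvu, hvt]) with h | ⟨i, hi, h⟩
          · exact Or.inl (by simp [h])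
          · exact Or.inr ⟨i, by simp [hi], Or.inl h⟩
    · push Not at ht
      refine ⟨M, hM, insert u I, hI', hind', fun a c hac => hsub (hMU a c hac), hdeg, ?_⟩
      intro v hv
      by_cases hvu : v = u
      · exact Or.inl (by simp [hvu])
      · rcases hcov v (by simp [hv, hvu, ht v hv]) with h | ⟨i, hi, h⟩
        · exact Or.inl (by simp [h])
        · exact Or.inr ⟨i, by simp [hi], h⟩

/-- Extremality controls only `T`. Minimizing the number of uncovered vertices makes the whole
uncovered part acyclic, since any cycle in it could be added. -/
lemma exists_good_acyclic {G F₁ : SimpleGraph V} {b : ℕ} (hb : 2 ≤ b) (hF₁ : F₁ ≤ G)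
    (hg₁ : Good b F₁) : ∃ F ≤ G, Good b F ∧ ind G (free F) ≤ ind G (free F₁) ∧
      ∀ T ⊆ free F, (G.induce (T : Set V)).IsAcyclic := by
  obtain ⟨F, ⟨hF, hg, hr⟩, hmin⟩ := exists_minimalFor_of_wellFoundedLT
    (fun F : SimpleGraph V => F ≤ G ∧ Good b F ∧ ind G (free F) ≤ ind G (free F₁))
    (fun F => (free F).card) ⟨F₁, hF₁, hg₁, le_rfl⟩
  refine ⟨F, hF, hg, hr, fun T hT => ?_⟩
  by_contra h
  obtain ⟨N, hN, Y, hY, ⟨y, hy⟩, hd⟩ := exists_cycle_graph h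
  have hY0 : ∀ v ∈ Y, ndeg F v = 0 := fun v hv => mem_free.1 (hT (hY hv))
  have hdisj : ∀ a b, F.Adj a b → ¬ N.Adj a b := by
    intro a b hab' hab
    have h1 := ndeg_pos_of_adj hab
    have h2 := ndeg_pos_of_adj hab'
    have h3 := hd a
    have h4 : a ∈ Y := by by_contra h; simp [h] at h3; omega
    have h5 := hY0 a h4
    omega
  have hsum : ∀ v, ndeg (F ⊔ N) v = ndeg F v + if v ∈ Y then 2 else 0 := fun v => by
    rw [ndeg_sup hdisj, hd]
  have hfree : free (F ⊔ N) ⊆ free F := by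
    intro v hv
    rw [mem_free, hsum] at hv
    rw [mem_free]
    omega
  have hcard : (free (F ⊔ N)).card < (free F).card := by
    refine Finset.card_lt_card ⟨hfree, fun h => ?_⟩
    have := h (mem_free.2 (hY0 y hy))
    rw [mem_free, hsum, if_pos hy] at this
    omega
  have := hmin (j := F ⊔ N) ⟨sup_le hF hN, fun v => ?_, (ind_mono hfree).trans hr⟩ hcard.le
  · simp only at this
    omega
  · have := hsum v
    have := hg v
    have := hY0 v
    split_ifs at * <;> grind

/-- A vertex covered by `F` has degree at least two, so its component has at least three vertices.
Small components therefore consist of forest vertices, and each contains a member of `I`. -/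
lemma exists_isPseudoFactor {G F : SimpleGraph V} {b : ℕ} (hb : 2 ≤ b) (hF : F ≤ G)
    (hg : Good b F) : ∃ (H : SimpleGraph V) (_ : DecidableRel H.Adj), G.IsPseudoFactor 2 b H ∧
      H.numEdgeOrVertexComponents ≤ ind G (free F) := by
  obtain ⟨F, hF, hg, hr, hac⟩ := exists_good_acyclic hb hF hg
  obtain ⟨M, hM, I, hI, hind, hMU, hdeg, hcov⟩ := exists_forest_cover _ (free F) le_rfl hac
  have hsum : ∀ v, ndeg (F ⊔ M) v = ndeg F v + ndeg M v := fun v => by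
    rw [ndeg_sup]
    intro a c h h'
    have := ndeg_pos_of_adj h
    have := mem_free.1 (hMU a c h')
    omega
  have hM0 : ∀ v, v ∉ free F → ndeg M v = 0 := by
    intro v hv
    by_contra hne
    obtain ⟨z, hz⟩ := (Set.ncard_pos).1 (Nat.pos_of_ne_zero hne)
    exact hv (hMU v z hz)
  refine ⟨F ⊔ M, inferInstance, ⟨sup_le hF hM, fun C hC x hx => ?_⟩, ?_⟩
  · rw [degree_eq_ndeg]
    by_cases hxf : x ∈ free F
    · exfalso
      have hnb : ∀ v, v ∈ free F → ∀ a c, (F ⊔ M).Adj v a → (F ⊔ M).Adj v c → a = c := by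
        intro v hv a c ha hc
        have h1 : ndeg (F ⊔ M) v ≤ 1 := by
          have := hdeg v
          rw [hsum, mem_free.1 hv]; omega
        exact (Set.ncard_le_one_iff).1 h1 ha hc
      have hfree : ∀ v a, v ∈ free F → (F ⊔ M).Adj v a → a ∈ free F := by
        intro v a hv h
        rcases h with h | h
        · have := ndeg_pos_of_adj h
          have := mem_free.1 hv
          omega
        · exact hMU a v h.symm
      have hreach : ∀ v, (F ⊔ M).Reachable x v → v = x ∨ (F ⊔ M).Adj x v := by
        intro v h
        obtain ⟨p⟩ := h.symm
        induction p with
        | nil => exact Or.inl rfl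
        | @cons v a _ hva p ih =>
          rcases ih hx hxf p.reachable.symm with rfl | h
          · exact Or.inr hva.symm
          · exact Or.inl (hnb a (hfree _ a hxf h) v _ hva.symm h.symm)
      have hsub : C.supp ⊆ insert x ((F ⊔ M).neighborSet x) := by
        intro v hv
        rw [ConnectedComponent.mem_supp_iff] at hv hx
        exact hreach v (ConnectedComponent.eq.1 (hx.trans hv.symm))
      have h1 := Set.ncard_le_ncard hsub
      have h2 := Set.ncard_insert_le x ((F ⊔ M).neighborSet x)
      have h3 : ((F ⊔ M).neighborSet x).ncard ≤ 1 := by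
        have := hsum x
        have := hdeg x
        have := mem_free.1 hxf
        unfold ndeg at *
        omega
      omega
    · have := hg x
      rw [hsum, hM0 x hxf]
      rw [mem_free] at hxf
      omega
  · unfold SimpleGraph.numEdgeOrVertexComponents
    have hsub : {C : (F ⊔ M).ConnectedComponent | C.supp.ncard = 2 ∨ C.supp.ncard = 1} ⊆
        ((I.image (F ⊔ M).connectedComponentMk : Finset _) : Set _) := by
      intro C hC
      rw [Set.mem_ofPred_eq] at hC
      obtain ⟨v, hv⟩ := C.nonempty_supp
      have hvf : v ∈ free F := by
        by_contra hvf
        rw [mem_free] at hvf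
        have h2 : 2 ≤ ndeg (F ⊔ M) v := by
          have := hg v
          rw [hsum]
          omega
        have h3 : insert v ((F ⊔ M).neighborSet v) ⊆ C.supp := by
          intro a ha
          rcases ha with rfl | ha
          · exact hv
          · exact C.mem_supp_of_adj_mem_supp hv ha
        have h4 := Set.ncard_le_ncard h3
        rw [Set.ncard_insert_of_notMem (by simp)] at h4
        unfold ndeg at h2
        omega
      rw [ConnectedComponent.mem_supp_iff] at hv
      rw [Finset.coe_image]
      rcases hcov v hvf with h | ⟨i, hi, h⟩
      · exact ⟨v, h, hv⟩
      · exact ⟨i, hi, hv ▸ ConnectedComponent.eq.2 (Adj.reachable (Or.inr h.symm))⟩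
    have h1 := Set.ncard_le_ncard hsub
    rw [Set.ncard_coe_finset] at h1
    exact h1.trans (Finset.card_image_le.trans ((card_le_ind hI hind).trans hr))

/-- Some subgraph with degrees in `{0} ∪ [2,b]` covers all vertices, or leaves at most
`α - ⌊b(δ-1)/2⌋` independent vertices uncovered, where `δ` is the minimum degree. -/
lemma exists_good_minDegree (G : SimpleGraph V) {b : ℕ} (hb : 4 ≤ b) :
    ∃ F ≤ G, Good b F ∧
      (free F = ∅ ∨ b * (G.minDegree - 1) + 2 * ind G (free F) ≤ 2 * G.indepNum + 1) := by
  by_cases h : ∀ F ≤ G, Good b F → (free F).Nonempty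
  · obtain ⟨F, T, hE⟩ := exists_isExtremal G b h
    exact ⟨F, hE.le, hE.good, Or.inr (hE.minDegree_bound hb)⟩
  · push Not at h
    obtain ⟨F, hF, hg, hempty⟩ := h
    exact ⟨F, hF, hg, Or.inl hempty⟩

end

end PseudoFactor

theorem theorem1 {V : Type*} [Fintype V] (G : SimpleGraph V) [DecidableRel G.Adj]
    (b : ℕ) (hb : 4 ≤ b) (hδ : 1 ≤ G.minDegree)
    (hα : (b : ℚ) * ((G.minDegree : ℚ) - 1) / 2 < (G.indepNum : ℚ)) :
    ∃ (H : SimpleGraph V) (_ : DecidableRel H.Adj), G.IsPseudoFactor 2 b H ∧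
      (H.numEdgeOrVertexComponents : ℤ) ≤
        (G.indepNum : ℤ) - ⌊(b : ℚ) / 2 * ((G.minDegree : ℚ) - 1)⌋ := by
  obtain ⟨F, hF, hg, hbound⟩ := PseudoFactor.exists_good_minDegree G hb
  obtain ⟨H, hdec, hH, hnum⟩ := PseudoFactor.exists_isPseudoFactor (by omega) hF hg
  refine ⟨H, hdec, hH, ?_⟩
  obtain ⟨d, hd⟩ : ∃ d, G.minDegree = d + 1 := ⟨G.minDegree - 1, by omega⟩
  rw [hd] at hα
  have hfloor : ⌊(b : ℚ) / 2 * ((G.minDegree : ℚ) - 1)⌋ = ((b * d / 2 : ℕ) : ℤ) := by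
    have e : (b : ℚ) / 2 * ((G.minDegree : ℚ) - 1) = ((b * d : ℕ) : ℚ) / ((2 : ℕ) : ℚ) := by
      rw [hd]
      push_cast
      ring
    rw [e, Rat.floor_natCast_div_natCast]
    push_cast
    rfl
  have hα' : b * d < 2 * G.indepNum := by
    have : ((b * d : ℕ) : ℚ) < ((2 * G.indepNum : ℕ) : ℚ) := by
      push_cast at hα ⊢
      linarith
    exact_mod_cast this
  rw [hfloor]
  -- If everything is covered, `hα'` makes the right side nonnegative. Otherwise the extra 1 in the
  -- bound is absorbed by rounding b(δ-1)/2 down.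
  rcases hbound with h | h
  · rw [h, PseudoFactor.ind_empty] at hnum
    omega
  · have h' : b * d + 2 * PseudoFactor.ind G (PseudoFactor.free F) ≤ 2 * G.indepNum + 1 := by
      have e : d = G.minDegree - 1 := by omega
      rw [e]
      convert h
    omega
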